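/- Let $F$ be an algebraically closed field of characteristic $p>2$ and let $n\ge 2$. Identify the characters of the diagonal torus $T(n)$ of $\mathrm{GL}(n)=\mathrm{GL}_n(F)$ with $\mathbb{Z}^n$, let $\epsilon_1,\dots,\epsilon_n$ be the standard basis, $\alpha_r=\epsilon_r-\epsilon_{r+1}$ for $1\le r<n$, and $\alpha(a,b)=\sum_{r=a}^{b-1}\alpha_r$. Write $\mu\le\lambda$ if $\lambda-\mu$ is a linear combination of the simple roots $\alpha_r$ with nonnegative integer coefficients (for $\mathrm{GL}(n-2)$ likewise, with $1\le r<n-2$), and let $\overline{\overline{\mu}}\in\mathbb{Z}^{n-2}$ be obtained from $\mu\in\mathbb{Z}^n$ by deleting the last two entries. For a dominant (weakly decreasing) weight $\lambda$ let $L_n(\lambda)$ be the simple rational $\mathrm{GL}(n)$-module of highest weight $\lambda$, and $L_n(\lambda)_\mu$ its weight spaces. Let $\lambda\in\mathbb{Z}^n$ be dominant with $\lambda_{n-1}=\lambda_n=0$ and $\lambda\neq 0$, let $\lambda_s$ be the last nonzero entry of $\lambda$, and let $1\le i\le s-1$. For $1\le j\le s-1$ put $\mu_j=\lambda-\alpha(j,n-1)-\alpha(s,n)$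 and $\omega_j=\lambda-\alpha(j,n-1)-\alpha(s,n-1)$. Let $L_n(\lambda)^{(1,1)}$ be the sum of the weight spaces $L_n(\lambda)_\mu$ with $\mu_{n-1}=\lambda_{n-1}+1$ and $\mu_n=\lambda_n+1$, and let $$L_n(\lambda)^{(1,1)\times}=\{v\in L_n(\lambda)^{(1,1)} : E_{n-1,n}v=0\},$$ where $E_{n-1,n}v$ is the coefficient of $c$ in the polynomial function $c\mapsto (1+c\,y_{n-1,n})v$ of $c \in F$, $y_{n-1,n}$ being the matrix unit; this subspace is a $\mathrm{GL}(n-2)$-submodule of $L_n(\lambda)$ for the embedding $g\mapsto\mathrm{diag}(g,1,1)$. Let $\nu\in\mathbb{Z}^n$ be the $\mathrm{GL}(n)$-weight of a nonzero weight vector in $L_n(\lambda)^{(1,1)\times}$. Suppose that $\overline{\overline{\omega_i}}\le\overline{\overline{\nu}}$ and that $L_{n-2}(\overline{\overline{\nu}})$ is a composition factor of the $\mathrm{GL}(n-2)$-module $L_n(\lambda)^{(1,1)\times}$. Then $\nu=\mu_j$ for some $j$ with $i\le j\le s-1$. -/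

import Mathlib

/-!
Rational representations of `GL_n(F)` for an infinite field `F`, their weights, the simple modules
`L_n(lam)`, and the `GL_{n-2}(F)`-stable subspaces `L_n(lam)^{(a,b)×}`.

Coordinates are numbered from `0`. A weight (character of the diagonal torus) of `GL_n(F)` is an
`n`-tuple of integers, that is, a function `Fin n → ℤ`.
-/

namespace GLRep

open Matrix

noncomputable section

/-! ### Weights -/

/-- The simple root `α_r = ε_r - ε_{r+1}` (for `r + 1 < n`). -/
def simpleRoot (n r : ℕ) : Fin n → ℤ :=
  fun k => (if (k : ℕ) = r then 1 else 0) - (if (k : ℕ) = r + 1 then 1 else 0)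

/-- The sum of simple roots `α(a,b) = α_a + ⋯ + α_{b-1}`. -/
def rootSum (n a b : ℕ) : Fin n → ℤ := ∑ r ∈ Finset.Ico a b, simpleRoot n r

/-- The dominance order: `mu ≤ lam` iff `lam - mu` is a sum of simple roots of `GL_n`. -/
def Subdominant {n : ℕ} (mu lam : Fin n → ℤ) : Prop :=
  lam - mu ∈ AddSubmonoid.closure {α : Fin n → ℤ | ∃ r : ℕ, r + 1 < n ∧ α = simpleRoot n r}

/-- The `n`-tuple obtained from an `(n+2)`-tuple by deleting the last two entries. -/
def dropTwo {m : ℕ} (mu : Fin (m + 2) → ℤ) : Fin m → ℤ := fun k => mu (Fin.castAdd 2 k)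

/-- The weight `μ_i = lam - α(i,n-1) - α(s,n)` of `GL_n`, with `n = m + 2`; in numbering from `0`
the last two coordinates are `m` and `m + 1`. -/
def muWeight {m : ℕ} (lam : Fin (m + 2) → ℤ) (s i : Fin (m + 2)) : Fin (m + 2) → ℤ :=
  lam - rootSum (m + 2) i m - rootSum (m + 2) s (m + 1)

/-- The weight `ω_i = lam - α(i,n-1) - α(s,n-1)` of `GL_n`, with `n = m + 2`. -/
def omegaWeight {m : ℕ} (lam : Fin (m + 2) → ℤ) (s i : Fin (m + 2)) : Fin (m + 2) → ℤ :=
  lam - rootSum (m + 2) i m - rootSum (m + 2) s m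

/-! ### Elements and subgroups of `GL_n` -/

/-- The element `diag (t_0, …, t_{n-1})` of the diagonal torus. -/
def diagGL {F : Type*} [Field F] {n : ℕ} (t : Fin n → Fˣ) : GL (Fin n) F where
  val := diagonal fun k => (t k : F)
  inv := diagonal fun k => ((t k)⁻¹ : F)
  val_inv := by simp
  inv_val := by simp

/-- The element `1 + c y_{ij}` of the root subgroup of the root `ε_i - ε_j`. -/
def rootElt {F : Type*} [Field F] {n : ℕ} (i j : Fin n) (h : i ≠ j) (c : F) : GL (Fin n) F where
  val := transvection i j c
  inv := transvection i j (-c)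
  val_inv := by rw [transvection_mul_transvection_same _ _ h, add_neg_cancel, transvection_zero]
  inv_val := by rw [transvection_mul_transvection_same _ _ h, neg_add_cancel, transvection_zero]

/-- The embedding `GL_m → GL_{m+2}`, `g ↦ diag (g, 1, 1)`. -/
def blockEmb (F : Type*) [Field F] (m : ℕ) : GL (Fin m) F →* GL (Fin (m + 2)) F :=
  Units.map
    { toFun := fun g =>
        reindex finSumFinEquiv finSumFinEquiv (fromBlocks g 0 0 (1 : Matrix (Fin 2) (Fin 2) F))
      map_one' := by simp [fromBlocks_one]
      map_mul' := fun g h => by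
        simp [fromBlocks_multiply] }

/-! ### Rational representations and the simple modules -/

section Rep

variable {F : Type*} [Field F] {n : ℕ} {V : Type*} [AddCommGroup V] [Module F V]

/-- A (finite-dimensional) rational representation: every matrix coefficient is a polynomial in the
matrix entries divided by a power of the determinant. -/
def IsRational (ρ : Representation F (GL (Fin n) F) V) : Prop :=
  Module.Finite F V ∧ ∀ (f : Module.Dual F V) (v : V),
    ∃ (P : MvPolynomial (Fin n × Fin n) F) (k : ℕ), ∀ g : GL (Fin n) F,
      f (ρ g v) = MvPolynomial.eval (fun ab => (g : Matrix (Fin n) (Fin n) F) ab.1 ab.2) P *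
        ((g : Matrix (Fin n) (Fin n) F).det)⁻¹ ^ k

/-- The weight space `V_mu = {v | t v = mu(t) v for all t in the diagonal torus}`. -/
def weightSpace (ρ : Representation F (GL (Fin n) F) V) (mu : Fin n → ℤ) : Submodule F V where
  carrier := {v | ∀ t : Fin n → Fˣ, ρ (diagGL t) v = ((∏ k, t k ^ mu k : Fˣ) : F) • v}
  zero_mem' := fun t => by simp
  add_mem' := fun {v w} hv hw t => by rw [map_add, hv t, hw t, smul_add]
  smul_mem' := fun a v hv t => by rw [map_smul, hv t, smul_comm]

/-- `mu` is a weight of the representation. -/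
def IsWeight (ρ : Representation F (GL (Fin n) F) V) (mu : Fin n → ℤ) : Prop :=
  weightSpace ρ mu ≠ ⊥

/-- The representation is (a copy of) `L_n(lam)`, the simple rational module of highest weight
`lam`, which is unique up to isomorphism. -/
structure IsSimpleOfHighestWeight (ρ : Representation F (GL (Fin n) F) V) (lam : Fin n → ℤ) :
    Prop where
  rational : IsRational ρ
  irreducible : ρ.IsIrreducible
  isWeight : IsWeight ρ lam
  subdominant : ∀ mu : Fin n → ℤ, IsWeight ρ mu → Subdominant mu lam

/-- `w = E^{(r)} v`, where `E^{(r)}` is the divided power `y_{ij}^{(r)}` in the hyperalgebra, acting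
on a rational module: `E^{(r)} v` is the coefficient of `c ^ r` in the polynomial function
`c ↦ (1 + c y_{ij}) v`, that is, `(1 + c y_{ij}) v = ∑ r, c ^ r E^{(r)} v`. -/
def IsDividedPower (ρ : Representation F (GL (Fin n) F) V) (i j : Fin n) (h : i ≠ j) (r : ℕ)
    (v w : V) : Prop :=
  ∃ a : ℕ →₀ V, (∀ c : F, ρ (rootElt i j h c) v = a.sum fun q x => c ^ q • x) ∧ a r = w

/-- The elements of the hyperalgebra act on every vector of a rational module. -/
theorem IsRational.exists_isDividedPower {ρ : Representation F (GL (Fin n) F) V}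
    (hρ : IsRational ρ) (i j : Fin n) (h : i ≠ j) (r : ℕ) (v : V) :
    ∃ w, IsDividedPower ρ i j h r v w := by
  obtain ⟨hfin, hpoly⟩ := hρ
  let b := Module.finBasis F V
  choose P e hP using fun q => hpoly (b.coord q) v
  let Q : Fin (Module.finrank F V) → Polynomial F := fun q =>
    MvPolynomial.aeval (fun ab : Fin n × Fin n =>
      Polynomial.C ((1 : Matrix (Fin n) (Fin n) F) ab.1 ab.2) +
        Polynomial.X * Polynomial.C (Matrix.single i j (1 : F) ab.1 ab.2)) (P q)
  have hQ : ∀ q c, (Q q).eval c = b.coord q (ρ (rootElt i j h c) v) := by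
    intro q c
    rw [hP]
    have hdet : ((rootElt i j h c : GL (Fin n) F) : Matrix (Fin n) (Fin n) F).det = 1 :=
      det_transvection_of_ne i j h c
    rw [hdet, inv_one, one_pow, mul_one]
    change Polynomial.aeval c (Q q) = _
    simp only [Q]
    rw [← MvPolynomial.aeval_eq_eval]
    rw [← AlgHom.comp_apply, MvPolynomial.comp_aeval]
    congr 2
    funext ab
    simp only [rootElt, transvection, Matrix.single_apply, Matrix.add_apply]
    split_ifs <;> simp
  refine ⟨_, ∑ q, Finsupp.mapRange (fun x : F => x • b q) (zero_smul _ _)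
    (Finsupp.ofSupportFinite (Q q).coeff ((Q q).support.finite_toSet.subset (by
      intro x hx; simpa using hx))), fun c => ?_, rfl⟩
  rw [← Finsupp.sum_finsetSum_index (by simp) (by simp [smul_add])]
  conv_lhs => rw [← b.sum_repr (ρ (rootElt i j h c) v)]
  refine Finset.sum_congr rfl fun q _ => ?_
  rw [Finsupp.sum_mapRange_index (by simp)]
  have := hQ q c
  rw [Module.Basis.coord_apply] at this
  rw [← this, Polynomial.eval_eq_sum, Polynomial.sum, Finset.sum_smul]
  rw [Finsupp.sum_of_support_subset (s := (Q q).support)]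
  · refine Finset.sum_congr rfl fun x _ => ?_
    simp only [Finsupp.ofSupportFinite, smul_smul, mul_comm]
    rfl
  · intro x hx
    simpa [Finsupp.ofSupportFinite] using hx
  · simp

/-- Over an infinite field the action of the hyperalgebra is single-valued. -/
theorem IsDividedPower.unique [Infinite F] {ρ : Representation F (GL (Fin n) F) V}
    {i j : Fin n} {h : i ≠ j} {r : ℕ} {v w w' : V}
    (hw : IsDividedPower ρ i j h r v w) (hw' : IsDividedPower ρ i j h r v w') : w = w' := by
  obtain ⟨a, ha, rfl⟩ := hw
  obtain ⟨a', ha', rfl⟩ := hw'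
  refine (Module.forall_dual_apply_eq_zero_iff F (a r - a' r)).1 (fun f => ?_) |> sub_eq_zero.1
  let p : (ℕ →₀ V) → Polynomial F := fun a => a.sum fun q x => Polynomial.monomial q (f x)
  have hp : ∀ a c, (p a).eval c = f (a.sum fun q x => c ^ q • x) := by
    intro a c
    simp [p, Finsupp.sum, Polynomial.eval_finsetSum, mul_comm]
  have hc : ∀ a, (p a).coeff r = f (a r) := by
    intro a
    simp only [p, Finsupp.sum, Polynomial.finsetSum_coeff, Polynomial.coeff_monomial]
    rw [Finset.sum_ite_eq']
    split_ifs with hr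
    · rfl
    · rw [Finsupp.notMem_support_iff.1 hr, map_zero]
  have : p a = p a' := Polynomial.funext fun c => by rw [hp, hp, ← ha, ← ha']
  rw [map_sub, ← hc, ← hc, this, sub_self]

/-- The kernel of `E_{ij} = E_{ij}^{(1)}`. -/
def rootKer (ρ : Representation F (GL (Fin n) F) V) (i j : Fin n) (h : i ≠ j) :
    Submodule F V where
  carrier := {v | IsDividedPower ρ i j h 1 v 0}
  zero_mem' := ⟨0, by simp, rfl⟩
  add_mem' := by
    rintro v w ⟨a, ha, ha1⟩ ⟨b, hb, hb1⟩
    refine ⟨a + b, fun c => ?_, by simp [ha1, hb1]⟩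
    rw [map_add, ha, hb, Finsupp.sum_add_index' (by simp) (by simp)]
  smul_mem' := by
    rintro x v ⟨a, ha, ha1⟩
    refine ⟨x • a, fun c => ?_, by simp [ha1]⟩
    rw [map_smul, ha, Finsupp.sum_smul_index' (by simp), Finsupp.smul_sum]
    simp only [smul_comm x]

end Rep

/-! ### Levels and composition factors -/

section Level

variable {F : Type*} [Field F] {m : ℕ} {V : Type*} [AddCommGroup V] [Module F V]

/-- The coordinate `n - 1` (numbering from `1`) of an `n`-tuple, `n = m + 2`. -/
abbrev penult (m : ℕ) : Fin (m + 2) := Fin.natAdd m (0 : Fin 2)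

/-- The coordinate `n` (numbering from `1`) of an `n`-tuple, `n = m + 2`. -/
abbrev ult (m : ℕ) : Fin (m + 2) := Fin.natAdd m (1 : Fin 2)

theorem penult_ne_ult (m : ℕ) : penult m ≠ ult m := by
  simp [penult, ult]

/-- The `(a,b)`-level: the sum of the weight spaces `V_mu` with `mu_{n-1} = lam_{n-1} + a` and
`mu_n = lam_n + b`. -/
def level (ρ : Representation F (GL (Fin (m + 2)) F) V) (lam : Fin (m + 2) → ℤ) (a b : ℤ) :
    Submodule F V :=
  ⨆ (mu : Fin (m + 2) → ℤ) (_ : mu (penult m) = lam (penult m) + a ∧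
    mu (ult m) = lam (ult m) + b), weightSpace ρ mu

/-- The subspace of the `(a,b)`-level annihilated by `E_{n-1,n}`. -/
def levelTimes (ρ : Representation F (GL (Fin (m + 2)) F) V) (lam : Fin (m + 2) → ℤ) (a b : ℤ) :
    Submodule F V :=
  level ρ lam a b ⊓ rootKer ρ (penult m) (ult m) (penult_ne_ult m)

/-- The restriction of a representation of `GL_n` to `GL_{n-2}`, `n = m + 2`. -/
def restrictTwo (ρ : Representation F (GL (Fin (m + 2)) F) V) :
    Representation F (GL (Fin m) F) V :=
  ρ.comp (blockEmb F m)

/-- The representation on the subquotient `B / A` (for `A ≤ B`). -/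
def subquotient {G : Type*} [Group G] {σ : Representation F G V} (A B : Subrepresentation σ) :
    Representation F G (B.toSubmodule ⧸ A.toSubmodule.comap B.toSubmodule.subtype) :=
  B.toRepresentation.quotient _ fun g _ hx => A.apply_mem_toSubmodule g hx

/-- `L_m(mu)` is a composition factor of the `GL_m`-module `N`, a stable subspace of the
representation `σ`: there are submodules `A ≤ B` of `N` with `B / A` isomorphic to `L_m(mu)`. -/
def IsCompositionFactor (σ : Representation F (GL (Fin m) F) V) (N : Submodule F V)
    (mu : Fin m → ℤ) : Prop :=
  ∃ A B : Subrepresentation σ, A ≤ B ∧ B.toSubmodule ≤ N ∧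
    IsSimpleOfHighestWeight (subquotient A B) mu

end Level

end

end GLRep

namespace GLRep

open Matrix

noncomputable section

/-! ### Simultaneous eigenvectors and vector-valued polynomials -/

section Eigen

variable {F V T ι : Type*} [Field F] [AddCommGroup V] [Module F V]

/-! Number entries from 0, with n = m + 2, and let d(k) be the sum of the first k entries of λ minus
that of ν. Dominance gives d ≥ 0. The hypothesis on ω_i bounds d(k), for k ≤ m, by [i < k] + [s <
k], with equality at k = m. Moreover d = 2 on s < k ≤ m, because weights have nonnegative entries
(`IsWeight.nonneg`) and λ vanishes after s. What remains unknown is where d takes the values 0 and 1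
on [0, s]; two facts about the module decide this.

By `prefixSum_eq_of_isCompositionFactor`, d(k) = 0 forces d = 0 below k. The vectors of top degree
in the first k coordinates form an irreducible module for the Levi subgroup GL_k × GL_{n-k}.
Restricted to GL_k this piece is a sum of translates of one simple module, so each of its nonzero
subquotients contains the weight formed by the first k entries of λ. If d(k) = 0, the composition
factor meets this piece, so it has a weight that agrees with λ on the first k coordinates and lies
below ν. Hence, if k is the largest index ≤ s with d(k) = 0, then d is 0 up to k, 1 on (k, s] and 2
on (s, m]: ν arises from λ by removing one unit at position k and one at s, and adding one to each
of the last two entries. For k < s this is μ_k.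

The case k = s is excluded by `eq_zero_of_mem_rootKer`. If E_{n-1,n}v = 0, a commutator computation
shows that E_{s,n-1} and E_{s,n} kill v as well. Then v is fixed by the unipotent radical of the
parabolic whose first block ends at s, without having top degree; density of the big cell
(`sup_below_eq_top`) makes such a vector zero. -/

theorem mem_of_sum_mem {f : T → Module.End F V} {B : Submodule F V}
    (hB : ∀ t, ∀ x ∈ B, f t x ∈ B) {χ : ι → T → F} (hχ : Function.Injective χ) (S : Finset ι) :
    ∀ {x : ι → V}, (∀ i ∈ S, ∀ t, f t (x i) = χ i t • x i) → ∑ i ∈ S, x i ∈ B →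
      ∀ i ∈ S, x i ∈ B := by
  classical
  induction S using Finset.induction with
  | empty => simp
  | insert j S hj ih =>
    intro x hx hsum
    have key : ∀ i ∈ S, x i ∈ B := by
      intro i hi
      have hij : χ i ≠ χ j := fun h => hj (hχ h ▸ hi)
      obtain ⟨t, ht⟩ := Function.ne_iff.1 hij
      -- Applying `f t - χ j t` removes the j-th term and rescales the others, the i-th by a nonzero
      -- factor.
      have h1 : ∑ i ∈ S, (χ i t - χ j t) • x i ∈ B := by
        have h2 := B.sub_mem (hB t _ hsum) (B.smul_mem (χ j t) hsum)
        rw [map_sum, Finset.smul_sum, ← Finset.sum_sub_distrib, Finset.sum_insert hj,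
          hx j (Finset.mem_insert_self _ _), sub_self, zero_add] at h2
        convert h2 using 1
        refine Finset.sum_congr rfl fun i hi => ?_
        rw [hx i (Finset.mem_insert_of_mem hi), sub_smul]
      have h3 := ih (x := fun i => (χ i t - χ j t) • x i) (fun i hi u => by
        rw [map_smul, hx i (Finset.mem_insert_of_mem hi), smul_comm]) h1 i hi
      exact (B.smul_mem_iff (sub_ne_zero.2 ht)).1 h3
    intro i hi
    rcases Finset.mem_insert.1 hi with rfl | hi
    · rw [Finset.sum_insert hj] at hsum
      exact (B.add_mem_iff_left (B.sum_mem key)).1 hsum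
    · exact key i hi

theorem eq_zero_of_sum_eq_zero {f : T → Module.End F V} {χ : ι → T → F}
    (hχ : Function.Injective χ) (S : Finset ι) {x : ι → V}
    (hx : ∀ i ∈ S, ∀ t, f t (x i) = χ i t • x i) (h : ∑ i ∈ S, x i = 0) :
    ∀ i ∈ S, x i = 0 := fun i hi =>
  (Submodule.mem_bot F).1 (mem_of_sum_mem (B := ⊥) (fun t x hx => by
    rw [(Submodule.mem_bot F).1 hx, map_zero]; exact zero_mem _) hχ S hx
    ((Submodule.mem_bot F).2 h) i hi)

/-- Applying `f t - ψ t` multiplies the i-th component by `χ i t - ψ t`, so components of any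
character other than `ψ` are pushed into `A`. This lifts weight vectors from subquotients and, with
`A = ⊥`, separates characters. -/
theorem mem_of_forall_sub_smul_mem {f : T → Module.End F V} {A : Submodule F V}
    (hA : ∀ t, ∀ x ∈ A, f t x ∈ A) {χ : ι → T → F} (hχ : Function.Injective χ) (S : Finset ι)
    {x : ι → V} (hx : ∀ i ∈ S, ∀ t, f t (x i) = χ i t • x i) {ψ : T → F}
    (h : ∀ t, f t (∑ i ∈ S, x i) - ψ t • ∑ i ∈ S, x i ∈ A) {i : ι} (hi : i ∈ S)
    (hψ : χ i ≠ ψ) : x i ∈ A := by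
  obtain ⟨t, ht⟩ := Function.ne_iff.1 hψ
  have h1 : ∑ i ∈ S, (χ i t - ψ t) • x i ∈ A := by
    convert h t using 1
    rw [map_sum, Finset.smul_sum, ← Finset.sum_sub_distrib]
    refine Finset.sum_congr rfl fun i hi => ?_
    rw [hx i hi, sub_smul]
  have h3 := mem_of_sum_mem hA hχ S (x := fun i => (χ i t - ψ t) • x i) (fun i hi u => by
    rw [map_smul, hx i hi, smul_comm]) h1 i hi
  exact (A.smul_mem_iff (sub_ne_zero.2 ht)).1 h3

theorem finsupp_ext_of_forall_sum_pow_smul [Infinite F] {a b : ℕ →₀ V}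
    (h : ∀ c : F, (a.sum fun q x => c ^ q • x) = b.sum fun q x => c ^ q • x) : a = b := by
  ext r
  refine (Module.forall_dual_apply_eq_zero_iff F (a r - b r)).1 (fun f => ?_) |> sub_eq_zero.1
  let p : (ℕ →₀ V) → Polynomial F := fun a => a.sum fun q x => Polynomial.monomial q (f x)
  have hp : ∀ a c, (p a).eval c = f (a.sum fun q x => c ^ q • x) := by
    intro a c
    simp [p, Finsupp.sum, Polynomial.eval_finsetSum, mul_comm]
  have hc : ∀ a, (p a).coeff r = f (a r) := by
    intro a
    simp only [p, Finsupp.sum, Polynomial.finsetSum_coeff, Polynomial.coeff_monomial]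
    rw [Finset.sum_ite_eq']
    split_ifs with hr
    · rfl
    · rw [Finsupp.notMem_support_iff.1 hr, map_zero]
  have : p a = p b := Polynomial.funext fun c => by rw [hp, hp, h]
  rw [map_sub, ← hc, ← hc, this, sub_self]

theorem finsupp_zero_apply_of_sum_pow_smul {a : ℕ →₀ V} {v : V}
    (h : (a.sum fun q x => (0 : F) ^ q • x) = v) : a 0 = v := by
  rw [← h, Finsupp.sum_of_support_subset (s := insert 0 a.support) _ (by simp) _ (by simp),
    Finset.sum_eq_single 0]
  · simp
  · intro b _ hb; simp [hb]
  · simp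

theorem sum_pow_smul_of_eq_zero {a : ℕ →₀ V} {N : ℕ} (h : ∀ q, N ≤ q → a q = 0) (c : F) :
    (a.sum fun q x => c ^ q • x) = ∑ q ∈ Finset.range N, c ^ q • a q := by
  refine Finsupp.sum_of_support_subset _ (fun q hq => ?_) _ (by simp)
  by_contra hq'
  exact Finsupp.mem_support_iff.1 hq (h q (by simpa using hq'))

theorem exists_unit_zpow_ne_one [Infinite F] {d : ℤ} (hd : d ≠ 0) : ∃ z : Fˣ, z ^ d ≠ 1 := by
  by_contra! h
  have hpos : 0 < d.natAbs := Int.natAbs_pos.2 hd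
  have h1 : ∀ z : Fˣ, z ^ d.natAbs = 1 := by
    intro z
    rcases Int.natAbs_eq d with h2 | h2
    · have := h z; rw [h2, zpow_natCast] at this; exact this
    · have := h z; rw [h2, _root_.zpow_neg, zpow_natCast, inv_eq_one] at this; exact this
  -- The extra factor X makes the identity hold at 0 too, hence on all of the infinite field.
  have h3 : (Polynomial.X ^ (d.natAbs + 1) - Polynomial.X : Polynomial F) = 0 := by
    refine Polynomial.funext fun c => ?_
    rcases eq_or_ne c 0 with rfl | hc
    · simp
    · have := congrArg Units.val (h1 (Units.mk0 c hc))
      simp only [Units.val_pow_eq_pow_val, Units.val_mk0, Units.val_one] at this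
      simp [pow_succ, this]
  have h4 := congrArg (fun p => Polynomial.coeff p 1) h3
  simp only [Polynomial.coeff_sub, Polynomial.coeff_X_pow, Polynomial.coeff_X_one,
    Polynomial.coeff_zero] at h4
  rw [if_neg (by omega)] at h4
  simp at h4

theorem exists_unit_zpow_ne [Infinite F] {d e : ℤ} (hd : d ≠ e) : ∃ z : Fˣ, z ^ d ≠ z ^ e := by
  obtain ⟨z, hz⟩ := exists_unit_zpow_ne_one (F := F) (sub_ne_zero.2 hd)
  exact ⟨z, fun h => hz (by rw [_root_.zpow_sub, h, mul_inv_cancel])⟩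

end Eigen

/-! ### Characters -/

section Character

variable (F : Type*) [Field F] {ι : Type*} [Fintype ι]

/-- The character of the torus `(Fˣ)^ι` with exponents `mu`. -/
def character (mu : ι → ℤ) (t : ι → Fˣ) : F := ((∏ k, t k ^ mu k : Fˣ) : F)

variable {F}

theorem character_mulSingle [DecidableEq ι] (mu : ι → ℤ) (k : ι) (z : Fˣ) :
    character F mu (Pi.mulSingle k z) = ((z ^ mu k : Fˣ) : F) := by
  unfold character
  rw [Finset.prod_eq_single k]
  · simp
  · intro b _ hb; simp [Pi.mulSingle_eq_of_ne hb]
  · simp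

theorem character_injective [Infinite F] : Function.Injective (character F (ι := ι)) := by
  classical
  intro mu nu h
  by_contra hne
  obtain ⟨k, hk⟩ := Function.ne_iff.1 hne
  obtain ⟨z, hz⟩ := exists_unit_zpow_ne (F := F) hk
  apply hz
  have := congrFun h (Pi.mulSingle k z)
  rw [character_mulSingle, character_mulSingle] at this
  exact Units.ext this

theorem character_add (mu nu : ι → ℤ) (t : ι → Fˣ) :
    character F (mu + nu) t = character F mu t * character F nu t := by
  rw [character, character, character, ← Units.val_mul, ← Finset.prod_mul_distrib]
  simp only [Pi.add_apply, _root_.zpow_add]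

theorem character_mul (mu : ι → ℤ) (s t : ι → Fˣ) :
    character F mu (s * t) = character F mu s * character F mu t := by
  simp [character, mul_zpow, Finset.prod_mul_distrib]

theorem character_one (mu : ι → ℤ) : character F mu 1 = 1 := by
  simp [character]

theorem character_zero (t : ι → Fˣ) : character F (0 : ι → ℤ) t = 1 := by
  simp [character]

theorem character_sumElim {α β : Type*} [Fintype α] [Fintype β] (e : α ⊕ β ≃ ι) (mu : ι → ℤ)
    (t : α → Fˣ) : character F mu (fun k => Sum.elim t 1 (e.symm k)) =
      character F (fun a => mu (e (Sum.inl a))) t := by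
  unfold character
  rw [← e.prod_comp, Fintype.prod_sum_type]
  simp

end Character

/-! ### Weights of rational modules -/

section Torus

variable {F : Type*} [Field F] {n : ℕ} {V : Type*} [AddCommGroup V] [Module F V]
  {ρ : Representation F (GL (Fin n) F) V}

theorem mem_weightSpace_iff {mu : Fin n → ℤ} {v : V} :
    v ∈ weightSpace ρ mu ↔ ∀ t, ρ (diagGL t) v = character F mu t • v := Iff.rfl

theorem diagGL_mul (s t : Fin n → Fˣ) : diagGL (s * t) = diagGL s * diagGL t := by
  refine Units.ext ?_
  simp [diagGL, diagonal_mul_diagonal]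

theorem diagGL_one : diagGL (1 : Fin n → Fˣ) = 1 := by
  ext a b
  simp [diagGL]

/-- The span of the characters, as an algebra of functions on the torus. -/
def characterAlgebra (F : Type*) [Field F] (n : ℕ) : Subalgebra F ((Fin n → Fˣ) → F) where
  carrier := {φ | ∃ l : (Fin n → ℤ) →₀ F, ∀ t, φ t = l.sum fun mu x => character F mu t * x}
  mul_mem' := by
    rintro φ ψ ⟨l, hl⟩ ⟨k, hk⟩
    refine ⟨l.sum fun mu x => k.sum fun nu y => Finsupp.single (mu + nu) (x * y), fun t => ?_⟩
    rw [Pi.mul_apply, hl, hk]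
    have h0 : ∀ mu : Fin n → ℤ, character F mu t * 0 = 0 := fun _ => mul_zero _
    have h1 : ∀ (mu : Fin n → ℤ) (x y : F), character F mu t * (x + y) =
      character F mu t * x + character F mu t * y := fun _ _ _ => mul_add _ _ _
    rw [Finsupp.sum_sum_index h0 h1, Finsupp.sum_mul]
    refine Finsupp.sum_congr fun mu _ => ?_
    rw [Finsupp.sum_sum_index h0 h1, Finsupp.mul_sum]
    refine Finsupp.sum_congr fun nu _ => ?_
    refine Eq.trans ?_ (Finsupp.sum_single_index (h := fun mu x => character F mu t * x)
      (h0 _)).symm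
    rw [character_add]
    ring
  add_mem' := by
    rintro φ ψ ⟨l, hl⟩ ⟨k, hk⟩
    refine ⟨l + k, fun t => ?_⟩
    rw [Pi.add_apply, hl, hk, Finsupp.sum_add_index' (by simp) (by intros; ring)]
  algebraMap_mem' c := ⟨Finsupp.single 0 c, fun t => by
    rw [Finsupp.sum_single_index (by simp), character_zero, one_mul]; rfl⟩

theorem character_mem_characterAlgebra (mu : Fin n → ℤ) :
    character F mu ∈ characterAlgebra F n :=
  ⟨Finsupp.single mu 1, fun t => by rw [Finsupp.sum_single_index (by simp), mul_one]⟩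

/-- On diagonal matrices every entry is a character or zero, and the inverse determinant is the
character with all exponents -1. -/
theorem IsRational.matrixCoeff_mem_characterAlgebra (hρ : IsRational ρ) (f : Module.Dual F V)
    (v : V) : (fun t => f (ρ (diagGL t) v)) ∈ characterAlgebra F n := by
  obtain ⟨P, k, h⟩ := hρ.2 f v
  have h1 : (fun t => f (ρ (diagGL t) v)) =
      (fun t => MvPolynomial.eval (fun ab : Fin n × Fin n =>
        (diagGL t : Matrix (Fin n) (Fin n) F) ab.1 ab.2) P) * character F (fun _ => -1) ^ k := by
    funext t
    rw [h, Pi.mul_apply, Pi.pow_apply]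
    congr 2
    simp [diagGL, character]
  rw [h1]
  refine mul_mem ?_ (pow_mem (character_mem_characterAlgebra _) _)
  clear h h1
  induction P using MvPolynomial.induction_on with
  | C a =>
    simp only [MvPolynomial.eval_C]
    exact (characterAlgebra F n).algebraMap_mem a
  | add p q hp hq =>
    simp only [map_add]
    exact add_mem hp hq
  | mul_X p ab hp =>
    simp only [map_mul, MvPolynomial.eval_X]
    refine mul_mem hp ?_
    rcases eq_or_ne ab.1 ab.2 with h | h
    · convert character_mem_characterAlgebra (Pi.single ab.1 1) using 1
      funext t
      simp only [diagGL, ← h, diagonal_apply_eq, character]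
      rw [Finset.prod_eq_single ab.1]
      · simp
      · intro b _ hb; simp [Pi.single_eq_of_ne hb]
      · simp
    · convert zero_mem (characterAlgebra F n) using 1
      funext t
      simp [diagGL, diagonal_apply_ne _ h]

theorem IsRational.exists_sum_character (hρ : IsRational ρ) (v : V) :
    ∃ w : (Fin n → ℤ) →₀ V, ∀ t, ρ (diagGL t) v = w.sum fun mu x => character F mu t • x := by
  have := hρ.1
  let b := Module.finBasis F V
  choose l hl using fun q => hρ.matrixCoeff_mem_characterAlgebra (b.coord q) v
  refine ⟨∑ q, Finsupp.mapRange (fun x : F => x • b q) (zero_smul _ _) (l q), fun t => ?_⟩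
  rw [← Finsupp.sum_finsetSum_index (by simp) (by simp [smul_add])]
  conv_lhs => rw [← b.sum_repr (ρ (diagGL t) v)]
  refine Finset.sum_congr rfl fun q _ => ?_
  rw [Finsupp.sum_mapRange_index (by simp)]
  have : b.repr (ρ (diagGL t) v) q = _ := hl q t
  rw [this, Finsupp.sum, Finset.sum_smul]
  exact Finset.sum_congr rfl fun x _ => (smul_smul _ _ _).symm

/-- Independence of characters with vector coefficients: the functions `s ↦ character F mu s • w mu`
are simultaneous eigenvectors of the translations of the torus. -/
theorem eq_zero_of_sum_character_smul [Infinite F] {ι : Type*} [Fintype ι]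
    (S : Finset (ι → ℤ)) {w : (ι → ℤ) → V}
    (h : ∀ t, ∑ mu ∈ S, character F mu t • w mu = 0) : ∀ mu ∈ S, w mu = 0 := by
  intro mu hmu
  have := eq_zero_of_sum_eq_zero (F := F) (V := (ι → Fˣ) → V) (T := ι → Fˣ)
    (f := fun t => LinearMap.funLeft F V (fun s => t * s)) character_injective S
    (x := fun mu s => character F mu s • w mu) (fun mu _ t => by
      funext s
      simp [LinearMap.funLeft_apply, character_mul, smul_smul])
    (by funext s; simpa using h s) mu hmu
  simpa [character_one] using congrFun this 1

/-- A rational module is the sum of its weight spaces. -/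
theorem IsRational.iSup_weightSpace [Infinite F] (hρ : IsRational ρ) :
    ⨆ mu, weightSpace ρ mu = ⊤ := by
  refine eq_top_iff.2 fun v _ => ?_
  obtain ⟨w, hw⟩ := hρ.exists_sum_character v
  rw [Submodule.mem_iSup_iff_exists_finsupp]
  refine ⟨w, fun mu => ?_, ?_⟩
  · by_cases hmu : mu ∈ w.support
    · rw [mem_weightSpace_iff]
      intro s
      -- Expanding the action of `s * t` on `v` in two ways and comparing the characters in `t`
      -- shows that each coefficient is an eigenvector.
      have h0 := eq_zero_of_sum_character_smul (F := F) w.support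
        (w := fun mu => ρ (diagGL s) (w mu) - character F mu s • w mu) (fun t => by
          have h1 := hw (s * t)
          rw [diagGL_mul, map_mul, Module.End.mul_apply, hw t, Finsupp.sum, Finsupp.sum,
            map_sum] at h1
          simp only [smul_sub, Finset.sum_sub_distrib]
          rw [sub_eq_zero]
          convert h1 using 1
          · exact Finset.sum_congr rfl fun mu _ => by rw [map_smul]
          · exact Finset.sum_congr rfl fun mu _ => by
              rw [smul_smul, character_mul, mul_comm]) mu hmu
      exact sub_eq_zero.1 h0
    · rw [Finsupp.notMem_support_iff.1 hmu]; exact zero_mem _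
  · have := hw 1
    rw [diagGL_one, map_one, Module.End.one_apply] at this
    rw [this]
    exact Finsupp.sum_congr fun mu _ => by rw [character_one, one_smul]

theorem IsRational.exists_weight_sum [Infinite F] (hρ : IsRational ρ) (v : V) :
    ∃ x : (Fin n → ℤ) →₀ V, (∀ mu, x mu ∈ weightSpace ρ mu) ∧
      ∑ mu ∈ x.support, x mu = v := by
  have : v ∈ ⨆ mu, weightSpace ρ mu := hρ.iSup_weightSpace ▸ Submodule.mem_top
  exact (Submodule.mem_iSup_iff_exists_finsupp _ _).1 this

/-- Components of an element of a torus-stable subspace lie in the subspace. -/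
theorem weight_component_mem [Infinite F] {B : Submodule F V}
    (hB : ∀ t, ∀ x ∈ B, ρ (diagGL t) x ∈ B) {x : (Fin n → ℤ) →₀ V}
    (hx : ∀ mu, x mu ∈ weightSpace ρ mu) (h : ∑ mu ∈ x.support, x mu ∈ B) (mu : Fin n → ℤ) :
    x mu ∈ B := by
  by_cases hmu : mu ∈ x.support
  · exact mem_of_sum_mem (f := fun t => ρ (diagGL t)) hB character_injective x.support
      (fun i _ t => hx i t) h mu hmu
  · rw [Finsupp.notMem_support_iff.1 hmu]; exact zero_mem _

theorem isWeight_of_mem {mu : Fin n → ℤ} {v : V} (hv : v ≠ 0) (h : v ∈ weightSpace ρ mu) :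
    IsWeight ρ mu := (Submodule.ne_bot_iff _).2 ⟨v, h, hv⟩

/-- The permutation matrices permute the weights. -/
theorem IsWeight.comp_perm {mu : Fin n → ℤ} (h : IsWeight ρ mu) (e : Equiv.Perm (Fin n)) :
    IsWeight ρ (mu ∘ e) := by
  obtain ⟨v, hv, hv0⟩ := (Submodule.ne_bot_iff _).1 h
  let g : GL (Fin n) F := ⟨e.permMatrix F, e⁻¹.permMatrix F, by
    rw [← Matrix.permMatrix_mul]; simp, by rw [← Matrix.permMatrix_mul]; simp⟩
  refine isWeight_of_mem (v := ρ g v) (fun h0 => hv0 ?_) fun t => ?_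
  · simpa using congrArg (ρ g⁻¹) h0
  · have h1 : diagGL t * g = g * diagGL (t ∘ e.symm) := by
      ext a b
      simp only [Units.val_mul, diagGL, g, diagonal_mul, mul_diagonal,
        Equiv.Perm.permMatrix, PEquiv.toMatrix_apply, Equiv.toPEquiv_apply, Option.mem_def,
        Option.some.injEq, Function.comp]
      split_ifs with h2
      · subst h2; simp [mul_comm]
      · simp
    rw [← Module.End.mul_apply, ← map_mul, h1, map_mul, Module.End.mul_apply, hv, map_smul]
    congr 2
    exact (Equiv.prod_comp e (fun k => (t ∘ e.symm) k ^ mu k)).symm.trans (by simp)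

end Torus

/-! ### The action of one-parameter subgroups on weight vectors -/

section Curve

variable {F : Type*} [Field F] {G : Type*} [Group G] {V : Type*} [AddCommGroup V] [Module F V]
  {ρ : Representation F G V}

/-- Conjugation by `t` rescales the parameter by `ψ`, so comparing coefficients of polynomials in
`c` gives the eigenvalue on each of them. For `t` in a torus, the q-th coefficient has its weight
shifted by q times the root. -/
theorem coeff_smul_of_semiconj [Infinite F] {g : F → G} {t : G} {ψ χ : F}
    (hg : ∀ c, t * g c = g (ψ * c) * t) {v : V} (hv : ρ t v = χ • v) {a : ℕ →₀ V}
    (ha : ∀ c, ρ (g c) v = a.sum fun q x => c ^ q • x) (q : ℕ) :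
    ρ t (a q) = (χ * ψ ^ q) • a q := by
  let a1 : ℕ →₀ V := a.mapRange (ρ t) (map_zero _)
  let a2 : ℕ →₀ V := Finsupp.onFinset a.support (fun q => (χ * ψ ^ q) • a q) (by
    intro q hq
    rw [Finsupp.mem_support_iff]
    rintro h
    exact hq (by rw [h, smul_zero]))
  have h : a1 = a2 := by
    refine finsupp_ext_of_forall_sum_pow_smul (F := F) fun c => ?_
    rw [Finsupp.sum_mapRange_index (by simp), Finsupp.onFinset_sum _ (by simp)]
    have h1 := congrArg (fun x => ρ x v) (hg c)
    simp only [map_mul, Module.End.mul_apply, hv, map_smul, ha] at h1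
    rw [Finsupp.sum, Finsupp.sum, map_sum, Finset.smul_sum] at h1
    simp only [map_smul, smul_smul] at h1 ⊢
    rw [Finsupp.sum, h1]
    refine Finset.sum_congr rfl fun q _ => ?_
    congr 1
    ring
  exact DFunLike.congr_fun h q

end Curve

/-! ### Block subgroups of `GL` -/

section Block

variable {F : Type*} [Field F] {α β : Type*} [Fintype α] [Fintype β] [DecidableEq α]
  [DecidableEq β]

/-- The Levi subgroup of block diagonal matrices. -/
def levi : GL α F × GL β F →* GL (α ⊕ β) F where
  toFun g :=
    { val := fromBlocks g.1 0 0 g.2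
      inv := fromBlocks (g.1⁻¹ : GL α F) 0 0 (g.2⁻¹ : GL β F)
      val_inv := by simp [fromBlocks_multiply, ← Units.val_mul, fromBlocks_one, -coe_units_inv]
      inv_val := by simp [fromBlocks_multiply, ← Units.val_mul, fromBlocks_one, -coe_units_inv] }
  map_one' := Units.ext (by simp [fromBlocks_one])
  map_mul' g h := Units.ext (by simp [fromBlocks_multiply])

/-- The upper unitriangular block matrices. -/
def upper (B : Matrix α β F) : GL (α ⊕ β) F where
  val := fromBlocks 1 B 0 1
  inv := fromBlocks 1 (-B) 0 1
  val_inv := by simp [fromBlocks_multiply, fromBlocks_one]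
  inv_val := by simp [fromBlocks_multiply, fromBlocks_one]

/-- The lower unitriangular block matrices. -/
def lower (C : Matrix β α F) : GL (α ⊕ β) F where
  val := fromBlocks 1 0 C 1
  inv := fromBlocks 1 0 (-C) 1
  val_inv := by simp [fromBlocks_multiply, fromBlocks_one]
  inv_val := by simp [fromBlocks_multiply, fromBlocks_one]

/-- The scalar matrix. -/
def scalarGL (ι : Type*) [Fintype ι] [DecidableEq ι] : Fˣ →* GL ι F :=
  Units.map (Matrix.scalar ι).toMonoidHom

theorem upper_add (B C : Matrix α β F) : upper (B + C) = upper B * upper C := by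
  refine Units.ext ?_
  simp [upper, fromBlocks_multiply, add_comm]

theorem upper_zero : upper (0 : Matrix α β F) = 1 := Units.ext (by simp [upper, fromBlocks_one])

theorem lower_zero : lower (0 : Matrix β α F) = 1 := Units.ext (by simp [lower, fromBlocks_one])

theorem upper_mul_levi (B : Matrix α β F) (g : GL α F × GL β F) :
    upper B * levi g = levi g * upper (((g.1⁻¹ : GL α F) : Matrix α α F) * B * (g.2 : Matrix β β F)) := by
  refine Units.ext ?_
  simp only [upper, levi, MonoidHom.coe_mk, OneHom.coe_mk, Units.val_mul, fromBlocks_multiply]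
  simp [← Matrix.mul_assoc, ← Units.val_mul, -coe_units_inv]

theorem scalar_mul_upper (z : Fˣ) (B : Matrix α β F) (c : F) :
    levi (scalarGL α z, 1) * upper (c • B) =
      upper (((z : F) * c) • B) * levi (scalarGL α z, 1) := by
  refine Units.ext ?_
  simp [upper, levi, scalarGL, fromBlocks_multiply, smul_smul, ← Matrix.smul_eq_diagonal_mul, mul_comm]

theorem scalar_mul_lower (z : Fˣ) (C : Matrix β α F) (c : F) :
    levi (scalarGL α z, 1) * lower (c • C) =
      lower (((z⁻¹ : Fˣ) * c : F) • C) * levi (scalarGL α z, 1) := by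
  refine Units.ext ?_
  ext a b
  rcases a with a | a <;> rcases b with b | b <;>
  simp [lower, levi, scalarGL, fromBlocks_multiply]
  field_simp

theorem scalar_mul_levi (z : Fˣ) (g : GL α F × GL β F) :
    levi (scalarGL α z, 1) * levi g = levi g * levi (scalarGL α z, 1) := by
  rw [← map_mul, ← map_mul]
  congr 1
  refine Prod.ext (Units.ext ?_) (by simp)
  ext a b
  simp [scalarGL, mul_comm]

/-- Block elimination through the Schur complement: a nonzero leading minor describes the big cell.
-/
theorem exists_eq_lower_mul_levi_mul_upper (g : GL (α ⊕ β) F)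
    (h : (toBlocks₁₁ (g : Matrix (α ⊕ β) (α ⊕ β) F)).det ≠ 0) :
    ∃ C l B, g = lower C * levi l * upper B := by
  set M := g.val with hM
  let A : GL α F := GeneralLinearGroup.mkOfDetNeZero _ h
  let : Invertible (toBlocks₁₁ M) := (toBlocks₁₁ M).invertibleOfIsUnitDet (Ne.isUnit h)
  have h1 := fromBlocks_eq_of_invertible₁₁ (toBlocks₁₁ M) (toBlocks₁₂ M) (toBlocks₂₁ M)
    (toBlocks₂₂ M)
  rw [fromBlocks_toBlocks] at h1
  have h2 : M.det ≠ 0 := (GeneralLinearGroup.det g).ne_zero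
  have h3 : (toBlocks₂₂ M - toBlocks₂₁ M * ⅟(toBlocks₁₁ M) * toBlocks₁₂ M).det ≠ 0 := by
    intro h0
    apply h2
    rw [h1, det_mul, det_mul, det_fromBlocks_zero₂₁ (toBlocks₁₁ M), h0, mul_zero, mul_zero,
      zero_mul]
  refine ⟨toBlocks₂₁ M * ⅟(toBlocks₁₁ M), (A, GeneralLinearGroup.mkOfDetNeZero _ h3),
    ⅟(toBlocks₁₁ M) * toBlocks₁₂ M, Units.ext ?_⟩
  exact h1

end Block

/-! ### The grading defined by a block decomposition -/

section Curve

variable {F : Type*} [Field F] {ι : Type*} [Fintype ι] [DecidableEq ι]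
  {V : Type*} [AddCommGroup V] [Module F V]

/-- The matrix coefficients are polynomials in the entries divided by powers of `det`. -/
def HasPolynomialCoeffs (σ : Representation F (GL ι F) V) : Prop :=
  ∀ (f : Module.Dual F V) (v : V), ∃ (P : MvPolynomial (ι × ι) F) (k : ℕ), ∀ g : GL ι F,
    f (σ g v) = MvPolynomial.eval (fun ab => (g : Matrix ι ι F) ab.1 ab.2) P *
      ((g : Matrix ι ι F).det)⁻¹ ^ k

/-- Since the determinant is 1 along the curve, the denominators disappear and matrix coefficients
become polynomials in `c`. -/
theorem HasPolynomialCoeffs.exists_curve_expansion [Module.Finite F V]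
    {σ : Representation F (GL ι F) V} (hσ : HasPolynomialCoeffs σ) {N : Matrix ι ι F}
    {g : F → GL ι F} (hg : ∀ c, (g c : Matrix ι ι F) = 1 + c • N)
    (hdet : ∀ c, (g c : Matrix ι ι F).det = 1) (v : V) :
    ∃ a : ℕ →₀ V, ∀ c, σ (g c) v = a.sum fun q x => c ^ q • x := by
  let b := Module.finBasis F V
  choose P e hP using fun q => hσ (b.coord q) v
  let Q : Fin (Module.finrank F V) → Polynomial F := fun q =>
    MvPolynomial.aeval (fun ab : ι × ι =>
      Polynomial.C ((1 : Matrix ι ι F) ab.1 ab.2) + Polynomial.X * Polynomial.C (N ab.1 ab.2))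
      (P q)
  have hQ : ∀ q c, (Q q).eval c = b.repr (σ (g c) v) q := by
    intro q c
    rw [← b.coord_apply, hP, hdet, inv_one, one_pow, mul_one]
    change Polynomial.aeval c (Q q) = _
    simp only [Q]
    rw [← MvPolynomial.aeval_eq_eval, ← AlgHom.comp_apply, MvPolynomial.comp_aeval]
    congr 2
    funext ab
    simp [hg]
    exact mul_comm _ _
  refine ⟨∑ q, Finsupp.mapRange (fun x : F => x • b q) (zero_smul _ _) (Q q).toFinsupp.coeff,
    fun c => ?_⟩
  rw [← Finsupp.sum_finsetSum_index (by simp) (by simp [smul_add])]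
  conv_lhs => rw [← b.sum_repr (σ (g c) v)]
  refine Finset.sum_congr rfl fun q _ => ?_
  rw [Finsupp.sum_mapRange_index (by simp), ← hQ, Polynomial.eval_eq_sum, Polynomial.sum,
    Finset.sum_smul]
  refine Finset.sum_congr rfl fun x _ => ?_
  rw [mul_comm, mul_smul]
  rfl

end Curve

section Grade

variable {F : Type*} [Field F] {α β : Type*} [Fintype α] [Fintype β] [DecidableEq α]
  [DecidableEq β] {V : Type*} [AddCommGroup V] [Module F V]
  {σ : Representation F (GL (α ⊕ β) F) V}

/-- The eigenspaces of the central one-parameter subgroup of the first block. -/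
def grade (σ : Representation F (GL (α ⊕ β) F) V) (r : ℤ) : Submodule F V where
  carrier := {v | ∀ z : Fˣ, σ (levi (scalarGL α z, 1)) v = ((z ^ r : Fˣ) : F) • v}
  zero_mem' := fun t => by simp
  add_mem' := fun {v w} hv hw t => by rw [map_add, hv t, hw t, smul_add]
  smul_mem' := fun a v hv t => by rw [map_smul, hv t, smul_comm]

/-- The sum of the lower graded pieces. -/
def below (σ : Representation F (GL (α ⊕ β) F) V) (r : ℤ) : Submodule F V :=
  ⨆ q : {q : ℤ // q < r}, grade σ q

theorem grade_le_below {q r : ℤ} (h : q < r) : grade σ q ≤ below σ r :=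
  le_iSup (fun q : {q : ℤ // q < r} => grade σ q) ⟨q, h⟩

theorem zpow_unit_injective [Infinite F] :
    Function.Injective (fun (r : ℤ) (z : Fˣ) => ((z ^ r : Fˣ) : F)) := by
  intro q r h
  by_contra hne
  obtain ⟨z, hz⟩ := exists_unit_zpow_ne (F := F) hne
  exact hz (Units.ext (congrFun h z))

theorem eq_of_mem_grade [Infinite F] {q r : ℤ} {v : V} (hv : v ≠ 0) (hq : v ∈ grade σ q)
    (hr : v ∈ grade σ r) : q = r :=
  zpow_unit_injective (F := F) (funext fun z =>
    smul_left_injective F hv ((hq z).symm.trans (hr z)))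

theorem grade_inf_below [Infinite F] {r : ℤ} {v : V} (hv : v ∈ grade σ r)
    (hv' : v ∈ below σ r) : v = 0 := by
  obtain ⟨x, hx, rfl⟩ := (Submodule.mem_iSup_iff_exists_finsupp _ _).1 hv'
  refine Finset.sum_eq_zero fun i hi => ?_
  refine (Submodule.mem_bot F).1 (mem_of_forall_sub_smul_mem (A := ⊥)
    (f := fun z : Fˣ => σ (levi (scalarGL α z, 1)))
    (χ := fun (q : {q : ℤ // q < r}) z => ((z ^ (q : ℤ) : Fˣ) : F))
    (ψ := fun z => ((z ^ r : Fˣ) : F)) (fun z x hx => ?_) (fun q q' h => ?_) x.support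
    (fun i _ z => hx i z) (fun z => ?_) hi (fun h => ?_))
  · rw [(Submodule.mem_bot F).1 hx, map_zero]; exact zero_mem _
  · exact Subtype.ext (zpow_unit_injective (F := F) h)
  · rw [Submodule.mem_bot, sub_eq_zero]; exact hv z
  · exact i.2.ne (zpow_unit_injective (F := F) h)

theorem levi_mem_grade {r : ℤ} {v : V} (hv : v ∈ grade σ r) (l : GL α F × GL β F) :
    σ (levi l) v ∈ grade σ r := by
  intro z
  rw [← Module.End.mul_apply, ← map_mul, scalar_mul_levi, map_mul, Module.End.mul_apply, hv z,
    map_smul]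

/-! ### Block-unipotent subgroups and the grading. -/

theorem exists_upper_expansion [Infinite F] [Module.Finite F V] (hσ : HasPolynomialCoeffs σ)
    (B : Matrix α β F) {r : ℤ} {v : V} (hv : v ∈ grade σ r) :
    ∃ a : ℕ →₀ V, a 0 = v ∧ (∀ q : ℕ, a q ∈ grade σ (r + q)) ∧
      ∀ c : F, σ (upper (c • B)) v = a.sum fun q x => c ^ q • x := by
  obtain ⟨a, ha⟩ := hσ.exists_curve_expansion (N := fromBlocks 0 B 0 0)
    (g := fun c => upper (c • B)) (fun c => by
      simp only [upper, fromBlocks_smul, ← fromBlocks_one, fromBlocks_add]; simp)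
    (fun c => by simp [upper]) v
  have h0 := ha 0
  simp only [zero_smul, upper_zero, map_one, Module.End.one_apply] at h0
  refine ⟨a, finsupp_zero_apply_of_sum_pow_smul h0.symm, fun q z => ?_, ha⟩
  rw [coeff_smul_of_semiconj (g := fun c => upper (c • B)) (ψ := (z : F))
    (t := levi (scalarGL α z, 1)) (fun c => scalar_mul_upper z B c) (hv z) ha q]
  simp [_root_.zpow_add]

theorem exists_lower_expansion [Infinite F] [Module.Finite F V] (hσ : HasPolynomialCoeffs σ)
    (C : Matrix β α F) {r : ℤ} {v : V} (hv : v ∈ grade σ r) :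
    ∃ a : ℕ →₀ V, a 0 = v ∧ (∀ q : ℕ, a q ∈ grade σ (r - q)) ∧
      ∀ c : F, σ (lower (c • C)) v = a.sum fun q x => c ^ q • x := by
  obtain ⟨a, ha⟩ := hσ.exists_curve_expansion (N := fromBlocks 0 0 C 0)
    (g := fun c => lower (c • C)) (fun c => by
      simp only [lower, fromBlocks_smul, ← fromBlocks_one, fromBlocks_add]; simp)
    (fun c => by simp [lower]) v
  have h0 := ha 0
  simp only [zero_smul, lower_zero, map_one, Module.End.one_apply] at h0
  refine ⟨a, finsupp_zero_apply_of_sum_pow_smul h0.symm, fun q z => ?_, ha⟩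
  rw [coeff_smul_of_semiconj (g := fun c => lower (c • C)) (ψ := ((z⁻¹ : Fˣ) : F))
    (t := levi (scalarGL α z, 1)) (fun c => scalar_mul_lower z C c) (hv z) ha q]
  simp [_root_.zpow_sub]

/-- In the expansion the constant term is `v`, and each later coefficient has strictly lower degree.
-/
theorem lower_sub_mem_below [Infinite F] [Module.Finite F V] (hσ : HasPolynomialCoeffs σ)
    (C : Matrix β α F) {r : ℤ} {v : V} (hv : v ∈ grade σ r) :
    σ (lower C) v - v ∈ below σ r := by
  obtain ⟨a, h0, ha, hs⟩ := exists_lower_expansion hσ C hv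
  have h1 := hs 1
  simp only [one_smul, one_pow] at h1
  rw [h1, Finsupp.sum_of_support_subset (s := insert 0 a.support) _ (by simp) _ (by simp),
    ← Finset.add_sum_erase _ _ (Finset.mem_insert_self 0 _), h0, add_sub_cancel_left]
  refine Submodule.sum_mem _ fun q hq => grade_le_below ?_ (ha q)
  have : q ≠ 0 := Finset.ne_of_mem_erase hq
  omega

theorem upper_apply_eq_self [Infinite F] [Module.Finite F V] (hσ : HasPolynomialCoeffs σ)
    {r : ℤ} (htop : ∀ q, r < q → grade σ q = ⊥) (B : Matrix α β F) {v : V}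
    (hv : v ∈ grade σ r) : σ (upper B) v = v := by
  obtain ⟨a, h0, ha, hs⟩ := exists_upper_expansion hσ B hv
  have h1 := hs 1
  simp only [one_smul] at h1
  rw [h1, sum_pow_smul_of_eq_zero (N := 1)]
  · simp [h0]
  · intro q hq
    have := ha q
    rwa [htop _ (by omega), Submodule.mem_bot] at this

/-- A nonzero graded Levi-stable subspace fixed by the upper unitriangular block matrices generates
an irreducible module by applying lower unitriangular block matrices. -/
theorem sup_below_eq_top [Infinite F] [Module.Finite F V] (hσ : HasPolynomialCoeffs σ)
    (hirr : ∀ W : Submodule F V, (∀ g, ∀ x ∈ W, σ g x ∈ W) → W = ⊥ ∨ W = ⊤)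
    {X : Submodule F V} (hX : X ≠ ⊥) {r : ℤ} (hXr : X ≤ grade σ r)
    (hL : ∀ l, ∀ x ∈ X, σ (levi l) x ∈ X) (hU : ∀ B, ∀ x ∈ X, σ (upper B) x = x) :
    X ⊔ below σ r = ⊤ := by
  by_contra hne
  obtain ⟨f, hf0, hf⟩ := Submodule.exists_le_ker_of_lt_top _ (lt_top_iff_ne_top.2 hne)
  -- On the big cell `f` vanishes: the upper factor fixes X, the Levi factor preserves it, and the
  -- lower factor changes a vector of X only by terms of lower degree.
  have hbig : ∀ x ∈ X, ∀ g : GL (α ⊕ β) F,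
      (toBlocks₁₁ (g : Matrix (α ⊕ β) (α ⊕ β) F)).det ≠ 0 → f (σ g x) = 0 := by
    intro x hx g hg
    obtain ⟨C, l, B, rfl⟩ := exists_eq_lower_mul_levi_mul_upper g hg
    rw [map_mul, map_mul, Module.End.mul_apply, Module.End.mul_apply, hU B x hx]
    have h1 := hL l x hx
    have h2 := lower_sub_mem_below hσ C (hXr h1)
    have h3 := hf (Submodule.mem_sup_right h2)
    have h4 := hf (Submodule.mem_sup_left h1)
    rw [LinearMap.mem_ker] at h3 h4
    rwa [map_sub, h4, sub_zero] at h3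
  have hall : ∀ x ∈ X, ∀ g : GL (α ⊕ β) F, f (σ g x) = 0 := by
    intro x hx g
    obtain ⟨P, k, hP⟩ := hσ f x
    let D := (mvPolynomialX (α ⊕ β) (α ⊕ β) F)
    -- Density of the big cell: the numerator times the leading minor times the determinant vanishes
    -- at every matrix, and the last two are nonzero polynomials.
    have h1 : P * (toBlocks₁₁ D).det * D.det = 0 := by
      refine MvPolynomial.funext fun y => ?_
      have hD : (MvPolynomial.eval y).mapMatrix D = Matrix.of fun a b => y (a, b) := by
        ext a b; simp [D]
      have hD' : (MvPolynomial.eval y).mapMatrix (toBlocks₁₁ D) =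
          toBlocks₁₁ (Matrix.of fun a b => y (a, b)) := by
        ext a b; simp [D, toBlocks₁₁]
      rw [map_mul, map_mul, RingHom.map_det, RingHom.map_det, hD, hD', map_zero]
      by_cases hd : (Matrix.of fun a b => y (a, b)).det = 0
      · rw [hd, mul_zero]
      by_cases hd' : (toBlocks₁₁ (Matrix.of fun a b => y (a, b))).det = 0
      · rw [hd', mul_zero, zero_mul]
      have h2 := hbig x hx (GeneralLinearGroup.mkOfDetNeZero _ hd) hd'
      rw [hP] at h2
      rcases mul_eq_zero.1 h2 with h3 | h3
      · have h4 : MvPolynomial.eval y P = 0 := h3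
        rw [h4, zero_mul, zero_mul]
      · exact absurd h3 (pow_ne_zero _ (inv_ne_zero hd))
    have h2 : (toBlocks₁₁ D).det ≠ 0 := by
      intro h0
      have h3 := congrArg (MvPolynomial.eval fun ab => (1 : Matrix (α ⊕ β) (α ⊕ β) F) ab.1 ab.2) h0
      rw [RingHom.map_det, map_zero] at h3
      have h4 : (MvPolynomial.eval fun ab =>
          (1 : Matrix (α ⊕ β) (α ⊕ β) F) ab.1 ab.2).mapMatrix (toBlocks₁₁ D) = 1 := by
        ext a b
        simp [D, toBlocks₁₁, one_apply]
      rw [h4, det_one] at h3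
      exact one_ne_zero h3
    have h3 : P = 0 := by
      rcases mul_eq_zero.1 h1 with h3 | h3
      · exact (mul_eq_zero.1 h3).resolve_right h2
      · exact absurd h3 (det_mvPolynomialX_ne_zero _ _)
    rw [hP, h3, map_zero, zero_mul]
  let W : Submodule F V := Submodule.span F {y | ∃ g, ∃ x ∈ X, y = σ g x}
  have hW : W = ⊤ := by
    refine (hirr W fun g x hx => ?_).resolve_left ?_
    · refine Submodule.span_induction (p := fun x _ => σ g x ∈ W) ?_ ?_ ?_ ?_ hx
      · rintro _ ⟨h, x, hx, rfl⟩
        exact Submodule.subset_span ⟨g * h, x, hx, by simp⟩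
      · simp
      · intro x y _ _ hx hy; rw [map_add]; exact W.add_mem hx hy
      · intro a x _ hx; rw [map_smul]; exact W.smul_mem a hx
    · obtain ⟨x, hx, hx0⟩ := (Submodule.ne_bot_iff _).1 hX
      exact (Submodule.ne_bot_iff _).2 ⟨x, Submodule.subset_span ⟨1, x, hx, by simp⟩, hx0⟩
  have hle : W ≤ LinearMap.ker f := Submodule.span_le.2 (by
    rintro _ ⟨g, x, hx, rfl⟩
    exact hall x hx g)
  rw [hW, top_le_iff, LinearMap.ker_eq_top] at hle
  exact hf0 hle

/-- The top graded piece of an irreducible module is irreducible for the Levi subgroup. -/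
theorem eq_grade_of_levi_stable [Infinite F] [Module.Finite F V] (hσ : HasPolynomialCoeffs σ)
    (hirr : ∀ W : Submodule F V, (∀ g, ∀ x ∈ W, σ g x ∈ W) → W = ⊥ ∨ W = ⊤)
    {r : ℤ} (htop : ∀ q, r < q → grade σ q = ⊥)
    {X : Submodule F V} (hX : X ≠ ⊥) (hXr : X ≤ grade σ r)
    (hL : ∀ l, ∀ x ∈ X, σ (levi l) x ∈ X) : X = grade σ r := by
  refine le_antisymm hXr fun u hu => ?_
  have h := sup_below_eq_top hσ hirr hX hXr hL fun B x hx => upper_apply_eq_self hσ htop B (hXr hx)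
  obtain ⟨x, hx, w, hw, rfl⟩ := Submodule.mem_sup.1 (h ▸ Submodule.mem_top : u ∈ X ⊔ below σ r)
  have : w = 0 := grade_inf_below (((grade σ r).add_mem_iff_right (hXr hx)).1 hu) hw
  rwa [this, add_zero]

/-- Vectors outside of the top graded piece are moved by the upper unitriangular matrices. -/
theorem eq_zero_of_upper_fixed [Infinite F] [Module.Finite F V] (hσ : HasPolynomialCoeffs σ)
    (hirr : ∀ W : Submodule F V, (∀ g, ∀ x ∈ W, σ g x ∈ W) → W = ⊥ ∨ W = ⊤)
    {r q : ℤ} (hqr : q < r) (hr : grade σ r ≠ ⊥) {v : V} (hv : v ∈ grade σ q)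
    (hfix : ∀ B, σ (upper B) v = v) : v = 0 := by
  by_contra hv0
  let X : Submodule F V := Submodule.span F (Set.range fun l => σ (levi l) v)
  have hXq : X ≤ grade σ q := Submodule.span_le.2 (by
    rintro _ ⟨l, rfl⟩; exact levi_mem_grade hv l)
  -- The Levi subgroup normalises the upper unipotent group, so the whole Levi-span of `v` is fixed
  -- by it. That span and the degrees below it would then exhaust V, leaving nothing in degree r.
  have h := sup_below_eq_top hσ hirr (X := X)
    ((Submodule.ne_bot_iff _).2 ⟨v, Submodule.subset_span ⟨1, by simp⟩, hv0⟩) hXq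
    (fun l x hx => by
      refine Submodule.span_induction (p := fun x _ => σ (levi l) x ∈ X) ?_ ?_ ?_ ?_ hx
      · rintro _ ⟨l', rfl⟩
        exact Submodule.subset_span ⟨l * l', by simp⟩
      · simp
      · intro x y _ _ hx hy; rw [map_add]; exact X.add_mem hx hy
      · intro a x _ hx; rw [map_smul]; exact X.smul_mem a hx)
    (fun B x hx => by
      refine Submodule.span_induction (p := fun x _ => σ (upper B) x = x) ?_ ?_ ?_ ?_ hx
      · rintro _ ⟨l, rfl⟩
        change σ _ (σ _ v) = _
        rw [← Module.End.mul_apply, ← map_mul, upper_mul_levi, map_mul, Module.End.mul_apply, hfix]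
      · simp
      · intro x y _ _ hx hy; rw [map_add, hx, hy]
      · intro a x _ hx; rw [map_smul, hx])
  have hle : X ⊔ below σ q ≤ below σ r :=
    sup_le (hXq.trans (grade_le_below hqr)) (iSup_le fun p => grade_le_below (p.2.trans hqr))
  rw [h, top_le_iff] at hle
  obtain ⟨u, hu, hu0⟩ := (Submodule.ne_bot_iff _).1 hr
  exact hu0 (grade_inf_below hu (hle ▸ Submodule.mem_top))

end Grade

/-! ### Restriction of the top graded piece to the first block -/

section Clifford

variable {F : Type*} [Field F] {α β : Type*} [Fintype α] [Fintype β] [DecidableEq α]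
  [DecidableEq β] {V : Type*} [AddCommGroup V] [Module F V]
  {σ : Representation F (GL (α ⊕ β) F) V}

/-- A diagonal matrix, as an element of `GL`. -/
def torusElt {ι : Type*} [Fintype ι] [DecidableEq ι] (t : ι → Fˣ) : GL ι F where
  val := diagonal fun k => (t k : F)
  inv := diagonal fun k => ((t k)⁻¹ : F)
  val_inv := by simp
  inv_val := by simp

/-- The weight spaces for the torus of the first block. -/
def leftWeight (σ : Representation F (GL (α ⊕ β) F) V) (χ : α → ℤ) : Submodule F V where
  carrier := {v | ∀ t : α → Fˣ, σ (levi (torusElt t, 1)) v = character F χ t • v}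
  zero_mem' := fun t => by simp
  add_mem' := fun {v w} hv hw t => by rw [map_add, hv t, hw t, smul_add]
  smul_mem' := fun a v hv t => by rw [map_smul, hv t, smul_comm]

/-- Stability under the first block. -/
def LeftStable (σ : Representation F (GL (α ⊕ β) F) V) (X : Submodule F V) : Prop :=
  ∀ g : GL α F, ∀ x ∈ X, σ (levi (g, 1)) x ∈ X

theorem levi_comm_apply (g : GL α F) (h : GL β F) (v : V) :
    σ (levi (g, 1)) (σ (levi (1, h)) v) = σ (levi (1, h)) (σ (levi (g, 1)) v) := by
  simp only [← Module.End.mul_apply, ← map_mul]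
  simp

/-- The translates of X under the second block span a Levi-stable subspace, which must be the whole
irreducible top piece. Containments can therefore be tested on translates. -/
theorem grade_le_of_forall_right_mem [Infinite F] [Module.Finite F V]
    (hσ : HasPolynomialCoeffs σ)
    (hirr : ∀ W : Submodule F V, (∀ g, ∀ x ∈ W, σ g x ∈ W) → W = ⊥ ∨ W = ⊤)
    {r : ℤ} (htop : ∀ q, r < q → grade σ q = ⊥)
    {X Y : Submodule F V} (hX : X ≠ ⊥) (hXr : X ≤ grade σ r) (hXs : LeftStable σ X)
    (hY : ∀ h : GL β F, ∀ x ∈ X, σ (levi (1, h)) x ∈ Y) : grade σ r ≤ Y := by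
  let Z : Submodule F V := Submodule.span F {y | ∃ h : GL β F, ∃ x ∈ X, y = σ (levi (1, h)) x}
  have hZ : Z = grade σ r := by
    refine eq_grade_of_levi_stable hσ hirr htop ?_ ?_ fun l x hx => ?_
    · obtain ⟨x, hx, hx0⟩ := (Submodule.ne_bot_iff _).1 hX
      refine (Submodule.ne_bot_iff _).2 ⟨x, Submodule.subset_span ⟨1, x, hx, ?_⟩, hx0⟩
      rw [← Prod.one_eq_mk, map_one, map_one, Module.End.one_apply]
    · refine Submodule.span_le.2 ?_
      rintro _ ⟨h, x, hx, rfl⟩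
      exact levi_mem_grade (hXr hx) _
    · refine Submodule.span_induction (p := fun x _ => σ (levi l) x ∈ Z) ?_ ?_ ?_ ?_ hx
      · rintro _ ⟨h, x, hx, rfl⟩
        refine Submodule.subset_span ⟨l.2 * h, _, hXs l.1 x hx, ?_⟩
        have h1 : l * (1, h) = (1, l.2 * h) * (l.1, 1) := Prod.ext (by simp) (by simp)
        simp only [← Module.End.mul_apply, ← map_mul, h1]
      · simp
      · intro x y _ _ hx hy; rw [map_add]; exact Z.add_mem hx hy
      · intro a x _ hx; rw [map_smul]; exact Z.smul_mem a hx
  rw [← hZ]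
  refine Submodule.span_le.2 ?_
  rintro _ ⟨h, x, hx, rfl⟩
  exact hY h x hx

/-- Clifford's argument: the top piece is a sum of translates of a minimal stable X, and these are
again simple because the two blocks commute. A maximal stable C meeting A trivially must make A + C
absorb every translate. -/
theorem exists_leftStable_complement [Infinite F] [Module.Finite F V]
    (hσ : HasPolynomialCoeffs σ)
    (hirr : ∀ W : Submodule F V, (∀ g, ∀ x ∈ W, σ g x ∈ W) → W = ⊥ ∨ W = ⊤)
    {r : ℤ} (htop : ∀ q, r < q → grade σ q = ⊥) (hr : grade σ r ≠ ⊥)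
    {A : Submodule F V} (hAs : LeftStable σ A) :
    ∃ C, C ≤ grade σ r ∧ LeftStable σ C ∧ C ⊓ A = ⊥ ∧ grade σ r ≤ A ⊔ C := by
  obtain ⟨X, ⟨hX0, hXr, hXs⟩, hXmin⟩ := (wellFounded_lt (α := Submodule F V)).has_min
    {X | X ≠ ⊥ ∧ X ≤ grade σ r ∧ LeftStable σ X}
    ⟨grade σ r, hr, le_rfl, fun g x hx => levi_mem_grade hx _⟩
  obtain ⟨C, ⟨hCr, hCs, hCA⟩, hCmax⟩ := (wellFounded_gt (α := Submodule F V)).has_min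
    {C | C ≤ grade σ r ∧ LeftStable σ C ∧ C ⊓ A = ⊥}
    ⟨⊥, bot_le, fun g x hx => by
      rw [(Submodule.mem_bot F).1 hx, map_zero]; exact zero_mem _, bot_inf_eq _⟩
  refine ⟨C, hCr, hCs, hCA, grade_le_of_forall_right_mem hσ hirr htop hX0 hXr hXs fun h => ?_⟩
  have hACs : LeftStable σ (A ⊔ C) := by
    intro g x hx
    obtain ⟨a, ha, c, hc, rfl⟩ := Submodule.mem_sup.1 hx
    rw [map_add]
    exact Submodule.add_mem_sup (hAs g a ha) (hCs g c hc)
  -- By minimality of X, the translate hX either lies in A + C or meets it trivially; in the latter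
  -- case C + hX would contradict the maximality of C.
  let X' : Submodule F V := X ⊓ (A ⊔ C).comap (σ (levi (1, h)))
  have hX's : LeftStable σ X' := by
    rintro g x ⟨hx, hx'⟩
    refine ⟨hXs g x hx, ?_⟩
    rw [SetLike.mem_coe, Submodule.mem_comap, ← levi_comm_apply]
    exact hACs g _ hx'
  rcases eq_or_ne X' ⊥ with h0 | h0
  · let C' : Submodule F V := C ⊔ X.map (σ (levi (1, h)))
    have hC' : ¬ C < C' := by
      refine hCmax C' ⟨sup_le hCr ?_, fun g x hx => ?_, ?_⟩
      · rintro _ ⟨x, hx, rfl⟩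
        exact levi_mem_grade (hXr hx) _
      · obtain ⟨c, hc, _, ⟨y, hy, rfl⟩, rfl⟩ := Submodule.mem_sup.1 hx
        rw [map_add, levi_comm_apply]
        exact Submodule.add_mem_sup (hCs g c hc) ⟨_, hXs g y hy, rfl⟩
      · refine (Submodule.eq_bot_iff _).2 ?_
        rintro a ⟨ha, ha'⟩
        obtain ⟨c, hc, _, ⟨y, hy, rfl⟩, rfl⟩ := Submodule.mem_sup.1 ha
        have h1 : σ (levi (1, h)) y ∈ A ⊔ C := by
          have := Submodule.sub_mem_sup ha' hc
          rwa [add_sub_cancel_left] at this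
        have h2 : y ∈ X' := ⟨hy, h1⟩
        rw [h0, Submodule.mem_bot] at h2
        rw [h2, map_zero, add_zero] at ha' ⊢
        exact (Submodule.eq_bot_iff _).1 hCA c ⟨hc, ha'⟩
    have hle : C' ≤ C := by
      by_contra hle
      exact hC' (lt_of_le_not_ge le_sup_left hle)
    intro x hx
    exact Submodule.mem_sup_right (hle (Submodule.mem_sup_right ⟨x, hx, rfl⟩))
  · have h1 : X' = X := by
      by_contra hne
      exact hXmin X' ⟨h0, inf_le_left.trans hXr, hX's⟩ (lt_of_le_of_ne inf_le_left hne)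
    intro x hx
    rw [← h1] at hx
    exact hx.2

/-- If the top graded piece contains a vector of weight `χ₀` for the torus of the first block, then
so does each of its nonzero stable subspaces. -/
theorem exists_leftWeight_mem [Infinite F] [Module.Finite F V]
    (hσ : HasPolynomialCoeffs σ)
    (hirr : ∀ W : Submodule F V, (∀ g, ∀ x ∈ W, σ g x ∈ W) → W = ⊥ ∨ W = ⊤)
    {r : ℤ} (htop : ∀ q, r < q → grade σ q = ⊥) (hspan : ⨆ χ, leftWeight σ χ = ⊤)
    {χ₀ : α → ℤ} {v₀ : V} (hv0 : v₀ ≠ 0) (hv : v₀ ∈ grade σ r) (hv' : v₀ ∈ leftWeight σ χ₀)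
    {D : Submodule F V} (hD : D ≠ ⊥) (hDr : D ≤ grade σ r) (hDs : LeftStable σ D) :
    ∃ z ∈ D, z ≠ 0 ∧ z ∈ leftWeight σ χ₀ := by
  by_contra! hcon
  -- If D has no vector of weight `χ₀`, its translates lie in the sum Y of the other weight spaces,
  -- and then so does the whole top piece, including `v₀`.
  let Y : Submodule F V := ⨆ χ : {χ : α → ℤ // χ ≠ χ₀}, leftWeight σ χ
  have hY : ∀ h : GL β F, ∀ x ∈ D, σ (levi (1, h)) x ∈ Y := by
    intro h x hx
    have hx' : x ∈ ⨆ χ, leftWeight σ χ := hspan ▸ Submodule.mem_top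
    obtain ⟨y, hy, rfl⟩ := (Submodule.mem_iSup_iff_exists_finsupp _ _).1 hx'
    have hyD := mem_of_sum_mem (f := fun t => σ (levi (torusElt t, 1))) (B := D)
      (fun t x hx => hDs _ x hx) character_injective y.support (fun i _ t => hy i t) hx
    rw [Finsupp.sum, map_sum]
    refine Submodule.sum_mem _ fun χ hχ => ?_
    have hne : χ ≠ χ₀ := by
      rintro rfl
      exact hcon _ (hyD _ hχ) (Finsupp.mem_support_iff.1 hχ) (hy _)
    refine le_iSup (fun χ : {χ : α → ℤ // χ ≠ χ₀} => leftWeight σ χ) ⟨χ, hne⟩ fun t => ?_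
    rw [levi_comm_apply, hy χ t, map_smul]
  have hv0Y := grade_le_of_forall_right_mem hσ hirr htop hD hDr hDs hY hv
  obtain ⟨y, hy, hsum⟩ := (Submodule.mem_iSup_iff_exists_finsupp _ _).1 hv0Y
  refine hv0 (hsum ▸ Finset.sum_eq_zero fun χ hχ => ?_)
  refine (Submodule.mem_bot F).1 (mem_of_forall_sub_smul_mem (A := ⊥)
    (f := fun t => σ (levi (torusElt t, 1)))
    (χ := fun (χ : {χ : α → ℤ // χ ≠ χ₀}) => character F (χ : α → ℤ))
    (ψ := character F χ₀) (fun z x hx => ?_) (fun q q' h => ?_) y.support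
    (fun i _ z => hy i z) (fun z => ?_) hχ (fun h => ?_))
  · rw [(Submodule.mem_bot F).1 hx, map_zero]; exact zero_mem _
  · exact Subtype.ext (character_injective (F := F) h)
  · have hsum' : ∑ i ∈ y.support, y i = v₀ := hsum
    rw [Submodule.mem_bot, sub_eq_zero, hsum']; exact hv' z
  · exact χ.2 (character_injective (F := F) h)

/-- The top graded piece is isotypic as a module for the first block: every subquotient contains a
vector of weight `χ₀`. -/
theorem exists_leftWeight_mem_notMem [Infinite F] [Module.Finite F V]
    (hσ : HasPolynomialCoeffs σ)
    (hirr : ∀ W : Submodule F V, (∀ g, ∀ x ∈ W, σ g x ∈ W) → W = ⊥ ∨ W = ⊤)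
    {r : ℤ} (htop : ∀ q, r < q → grade σ q = ⊥) (hspan : ⨆ χ, leftWeight σ χ = ⊤)
    {χ₀ : α → ℤ} {v₀ : V} (hv0 : v₀ ≠ 0) (hv : v₀ ∈ grade σ r) (hv' : v₀ ∈ leftWeight σ χ₀)
    {A B : Submodule F V} (hAs : LeftStable σ A) (hBs : LeftStable σ B) (hAB : A ≤ B)
    (hBr : B ≤ grade σ r) (hne : ¬ B ≤ A) :
    ∃ z ∈ B, z ∉ A ∧ z ∈ leftWeight σ χ₀ := by
  -- A complement C of A replaces the subquotient by the nonzero subspace B ∩ C.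
  obtain ⟨C, hCr, hCs, hCA, hAC⟩ := exists_leftStable_complement hσ hirr htop
    ((Submodule.ne_bot_iff _).2 ⟨v₀, hv, hv0⟩) hAs
  have hD : B ⊓ C ≠ ⊥ := by
    intro h0
    apply hne
    intro b hb
    obtain ⟨a, ha, c, hc, rfl⟩ := Submodule.mem_sup.1 (hAC (hBr hb))
    have : c = 0 := (Submodule.eq_bot_iff _).1 h0 c ⟨(B.add_mem_iff_right (hAB ha)).1 hb, hc⟩
    rwa [this, add_zero]
  obtain ⟨z, hz, hz0, hzw⟩ := exists_leftWeight_mem hσ hirr htop hspan hv0 hv hv' hD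
    (inf_le_left.trans hBr) fun g x hx => ⟨hBs g x hx.1, hCs g x hx.2⟩
  exact ⟨z, hz.1, fun hzA => hz0 ((Submodule.eq_bot_iff _).1 hCA z ⟨hz.2, hzA⟩), hzw⟩

end Clifford

/-! ### Block decompositions of `GL_n` -/

section Reindex

variable {F : Type*} [Field F] {n : ℕ} {α β : Type*} [Fintype α] [Fintype β] [DecidableEq α]
  [DecidableEq β] {V : Type*} [AddCommGroup V] [Module F V]
  {ρ : Representation F (GL (Fin n) F) V}

/-- The identification of `GL` of a disjoint union with `GL_n`. -/
def blockIso (F : Type*) [Field F] (e : α ⊕ β ≃ Fin n) : GL (α ⊕ β) F ≃* GL (Fin n) F :=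
  Units.mapEquiv (reindexAlgEquiv F F e).toMulEquiv

theorem blockIso_val (e : α ⊕ β ≃ Fin n) (g : GL (α ⊕ β) F) :
    (blockIso F e g : Matrix (Fin n) (Fin n) F) = reindex e e g.val := rfl

/-- The representation seen as a representation of `GL` of a disjoint union. -/
def blockRep (ρ : Representation F (GL (Fin n) F) V) (e : α ⊕ β ≃ Fin n) :
    Representation F (GL (α ⊕ β) F) V :=
  ρ.comp (blockIso F e).toMonoidHom

theorem blockRep_apply (e : α ⊕ β ≃ Fin n) (g : GL (α ⊕ β) F) :
    blockRep ρ e g = ρ (blockIso F e g) := rfl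

theorem IsRational.hasPolynomialCoeffs (hρ : IsRational ρ) (e : α ⊕ β ≃ Fin n) :
    HasPolynomialCoeffs (blockRep ρ e) := by
  intro f v
  obtain ⟨P, k, h⟩ := hρ.2 f v
  refine ⟨MvPolynomial.rename (Prod.map e.symm e.symm) P, k, fun g => ?_⟩
  rw [blockRep_apply, h, blockIso_val, det_reindex_self, MvPolynomial.eval_rename]
  rfl

theorem stable_eq_bot_or_eq_top (h : ρ.IsIrreducible) (e : α ⊕ β ≃ Fin n) (W : Submodule F V)
    (hW : ∀ g, ∀ x ∈ W, blockRep ρ e g x ∈ W) : W = ⊥ ∨ W = ⊤ := by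
  have : IsSimpleOrder (Subrepresentation ρ) := h
  let W' : Subrepresentation ρ := ⟨W, fun g x hx => by
    have := hW ((blockIso F e).symm g) x hx
    rwa [blockRep_apply, MulEquiv.apply_symm_apply] at this⟩
  rcases eq_bot_or_eq_top W' with h1 | h1
  · exact Or.inl (congrArg Subrepresentation.toSubmodule h1)
  · exact Or.inr (congrArg Subrepresentation.toSubmodule h1)

theorem blockIso_levi_torusElt (e : α ⊕ β ≃ Fin n) (t : α → Fˣ) :
    blockIso F e (levi (torusElt t, 1)) = diagGL fun k => Sum.elim t 1 (e.symm k) := by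
  refine Units.ext ?_
  rw [blockIso_val]
  ext a b
  obtain ⟨a, rfl⟩ := e.surjective a
  obtain ⟨b, rfl⟩ := e.surjective b
  rcases a with a | a <;> rcases b with b | b <;>
  simp [levi, torusElt, diagGL, diagonal_apply, one_apply]

theorem weightSpace_le_leftWeight (e : α ⊕ β ≃ Fin n) (mu : Fin n → ℤ) :
    weightSpace ρ mu ≤ leftWeight (blockRep ρ e) (fun a => mu (e (Sum.inl a))) := by
  intro v hv t
  rw [blockRep_apply, blockIso_levi_torusElt, ← character_sumElim]
  exact hv _

theorem prod_zpow_eq_zpow_sum {G ι : Type*} [CommGroup G] (z : G) (s : Finset ι) (f : ι → ℤ) :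
    ∏ k ∈ s, z ^ f k = z ^ ∑ k ∈ s, f k := by
  classical
  induction s using Finset.induction with
  | empty => simp
  | insert a s ha ih => rw [Finset.prod_insert ha, Finset.sum_insert ha, ih, _root_.zpow_add]

theorem weightSpace_le_grade (e : α ⊕ β ≃ Fin n) (mu : Fin n → ℤ) :
    weightSpace ρ mu ≤ grade (blockRep ρ e) (∑ a, mu (e (Sum.inl a))) := by
  intro v hv z
  have h := weightSpace_le_leftWeight e mu hv (fun _ => z)
  have h1 : (torusElt fun _ : α => z) = scalarGL α z := Units.ext (by
    ext a b; simp [torusElt, scalarGL])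
  rw [h1] at h
  rw [h, character, prod_zpow_eq_zpow_sum]

theorem iSup_leftWeight [Infinite F] (hρ : IsRational ρ) (e : α ⊕ β ≃ Fin n) :
    ⨆ χ, leftWeight (blockRep ρ e) χ = ⊤ :=
  eq_top_iff.2 (hρ.iSup_weightSpace ▸
    iSup_le fun mu => (weightSpace_le_leftWeight e mu).trans (le_iSup _ _))

/-- The degree of a weight vector is the sum of its weight over the first block, and `he` says that
λ maximises this sum. -/
theorem grade_eq_bot [Infinite F] {lam : Fin n → ℤ} (hρ : IsSimpleOfHighestWeight ρ lam)
    (e : α ⊕ β ≃ Fin n)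
    (he : ∀ mu, Subdominant mu lam → ∑ a, mu (e (Sum.inl a)) ≤ ∑ a, lam (e (Sum.inl a)))
    (q : ℤ) (hq : ∑ a, lam (e (Sum.inl a)) < q) : grade (blockRep ρ e) q = ⊥ := by
  refine (Submodule.eq_bot_iff _).2 fun v hv => ?_
  obtain ⟨x, hx, rfl⟩ := hρ.rational.exists_weight_sum v
  refine Finset.sum_eq_zero fun mu hmu => ?_
  by_contra h0
  have h1 : x mu ∈ grade (blockRep ρ e) q := by
    refine weight_component_mem (B := grade (blockRep ρ e) q) (fun t y hy z => ?_) hx hv mu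
    have h2 := hy z
    rw [blockRep_apply] at h2 ⊢
    have h1 : (torusElt fun _ : α => z) = scalarGL α z := Units.ext (by
      ext a b; simp [torusElt, scalarGL])
    rw [← h1, blockIso_levi_torusElt] at h2 ⊢
    rw [← Module.End.mul_apply, ← map_mul, ← diagGL_mul, mul_comm, diagGL_mul, map_mul,
      Module.End.mul_apply, h2, map_smul]
  have h2 := eq_of_mem_grade h0 h1 (weightSpace_le_grade e mu (hx mu))
  have h3 := he mu (hρ.subdominant mu (isWeight_of_mem h0 (hx mu)))
  omega

theorem blockIso_upper_single (e : α ⊕ β ≃ Fin n) (a : α) (b : β) (c : F)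
    (h : e (Sum.inl a) ≠ e (Sum.inr b)) :
    blockIso F e (upper (Matrix.single a b c)) = rootElt (e (Sum.inl a)) (e (Sum.inr b)) h c := by
  refine Units.ext ?_
  rw [blockIso_val]
  ext i j
  obtain ⟨i, rfl⟩ := e.surjective i
  obtain ⟨j, rfl⟩ := e.surjective j
  rcases i with i | i <;> rcases j with j | j <;>
  simp [upper, rootElt, transvection, Matrix.single_apply, one_apply]

/-- A vector whose weight is not extremal with respect to the block decomposition is moved by some
root subgroup. -/
theorem eq_zero_of_rootElt_fixed [Infinite F] {lam nu : Fin n → ℤ}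
    (hρ : IsSimpleOfHighestWeight ρ lam) (e : α ⊕ β ≃ Fin n)
    (hlt : ∑ a, nu (e (Sum.inl a)) < ∑ a, lam (e (Sum.inl a))) {v : V}
    (hv : v ∈ weightSpace ρ nu)
    (hfix : ∀ (a : α) (b : β) (h : e (Sum.inl a) ≠ e (Sum.inr b)) (c : F),
      ρ (rootElt (e (Sum.inl a)) (e (Sum.inr b)) h c) v = v) : v = 0 := by
  have := hρ.rational.1
  obtain ⟨w, hw, hw0⟩ := (Submodule.ne_bot_iff _).1 hρ.isWeight
  refine eq_zero_of_upper_fixed (hρ.rational.hasPolynomialCoeffs e)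
    (stable_eq_bot_or_eq_top hρ.irreducible e) hlt
    ((Submodule.ne_bot_iff _).2 ⟨w, weightSpace_le_grade e lam hw, hw0⟩)
    (weightSpace_le_grade e nu hv) fun B => ?_
  -- The upper unipotent group is additive in `B`, so root elements generate it.
  induction B using Matrix.induction_on' with
  | h_zero => simp [upper_zero]
  | h_add p q hp hq => rw [upper_add, map_mul, Module.End.mul_apply, hq, hp]
  | h_std_basis a b c =>
    rw [blockRep_apply, blockIso_upper_single e a b c (by simp)]
    exact hfix _ _ _ _

/-- A subquotient of the top graded piece, stable under the first block and the torus, contains a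
weight vector whose weight agrees with the highest weight on the first block. -/
theorem exists_weight_eq_on_left [Infinite F] {lam : Fin n → ℤ}
    (hρ : IsSimpleOfHighestWeight ρ lam) (e : α ⊕ β ≃ Fin n)
    (he : ∀ mu, Subdominant mu lam → ∑ a, mu (e (Sum.inl a)) ≤ ∑ a, lam (e (Sum.inl a)))
    {A B : Submodule F V} (hAs : LeftStable (blockRep ρ e) A) (hBs : LeftStable (blockRep ρ e) B)
    (hAB : A ≤ B) (hBt : ∀ t, ∀ x ∈ B, ρ (diagGL t) x ∈ B)
    {nu : Fin n → ℤ} {b : V} (hb : b ∈ B) (hbA : b ∉ A) (hbnu : b ∈ weightSpace ρ nu)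
    (hnu : ∑ a, nu (e (Sum.inl a)) = ∑ a, lam (e (Sum.inl a))) :
    ∃ (mu : Fin n → ℤ) (z : V), z ∈ weightSpace ρ mu ∧ z ∈ B ∧ z ∉ A ∧
      ∀ a, mu (e (Sum.inl a)) = lam (e (Sum.inl a)) := by
  have := hρ.rational.1
  obtain ⟨w, hw, hw0⟩ := (Submodule.ne_bot_iff _).1 hρ.isWeight
  let U := grade (blockRep ρ e) (∑ a, lam (e (Sum.inl a)))
  have hUs : LeftStable (blockRep ρ e) U := fun g x hx => levi_mem_grade hx _
  have hbU : b ∈ U := by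
    have := weightSpace_le_grade e nu hbnu
    rwa [hnu] at this
  obtain ⟨z, hz, hzA, hzw⟩ := exists_leftWeight_mem_notMem (A := A ⊓ U) (B := B ⊓ U)
    (hρ.rational.hasPolynomialCoeffs e) (stable_eq_bot_or_eq_top hρ.irreducible e)
    (grade_eq_bot hρ e he) (iSup_leftWeight hρ.rational e) hw0 (weightSpace_le_grade e lam hw)
    (weightSpace_le_leftWeight e lam hw) (fun g x hx => ⟨hAs g x hx.1, hUs g x hx.2⟩)
    (fun g x hx => ⟨hBs g x hx.1, hUs g x hx.2⟩) (inf_le_inf_right _ hAB) inf_le_right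
    (fun hle => hbA (hle ⟨hb, hbU⟩).1)
  -- The vector `z` is a weight vector for the first block only. Some component for the full torus
  -- stays outside A, and it keeps the weight on the first block.
  obtain ⟨x, hx, rfl⟩ := hρ.rational.exists_weight_sum z
  have hxB := weight_component_mem hBt hx hz.1
  have hzA' : ∑ mu ∈ x.support, x mu ∉ A := fun h => hzA ⟨h, hz.2⟩
  obtain ⟨mu, hmu, hmuA⟩ : ∃ mu ∈ x.support, x mu ∉ A := by
    by_contra! h
    exact hzA' (A.sum_mem h)
  refine ⟨mu, x mu, hx mu, hxB mu, hmuA, ?_⟩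
  have hmem : x mu ∈ leftWeight (blockRep ρ e) (fun a => lam (e (Sum.inl a))) := by
    refine weight_component_mem (B := leftWeight (blockRep ρ e) _) (fun t y hy s => ?_) hx hzw mu
    have h2 := hy s
    rw [blockRep_apply, blockIso_levi_torusElt] at h2 ⊢
    rw [← Module.End.mul_apply, ← map_mul, ← diagGL_mul, mul_comm, diagGL_mul, map_mul,
      Module.End.mul_apply, h2, map_smul]
  have h0 : x mu ≠ 0 := Finsupp.mem_support_iff.1 hmu
  refine congrFun (character_injective (F := F) (funext fun t => smul_left_injective F h0
    ((weightSpace_le_leftWeight e mu (hx mu) t).symm.trans (hmem t))))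

/-! ### Divided powers on weight vectors. -/

theorem exists_rootElt_expansion [Infinite F] (hρ : IsRational ρ) {i j : Fin n} (h : i ≠ j)
    {nu : Fin n → ℤ} {v : V} (hv : v ∈ weightSpace ρ nu) :
    ∃ a : ℕ →₀ V, a 0 = v ∧
      (∀ q : ℕ, a q ∈ weightSpace ρ (nu + (q : ℤ) • (Pi.single i 1 - Pi.single j 1))) ∧
      ∀ c : F, ρ (rootElt i j h c) v = a.sum fun q x => c ^ q • x := by
  obtain ⟨_, a, ha, _⟩ := hρ.exists_isDividedPower i j h 0 v
  have h1 : rootElt (F := F) i j h 0 = 1 := Units.ext (by simp [rootElt])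
  have h0 := ha 0
  rw [h1, map_one, Module.End.one_apply] at h0
  refine ⟨a, finsupp_zero_apply_of_sum_pow_smul h0.symm, fun q t => ?_, ha⟩
  rw [coeff_smul_of_semiconj (g := rootElt i j h) (t := diagGL t)
    (ψ := ((t i * (t j)⁻¹ : Fˣ) : F)) (fun c => ?_) (hv t) ha q]
  · congr 1
    change character F nu t * _ = character F _ t
    rw [character_add]
    congr 1
    unfold character
    rw [Fintype.prod_eq_mul i j h]
    · simp [h, h.symm, mul_pow]
    · rintro k ⟨hi, hj⟩
      simp [Pi.single_eq_of_ne hi, Pi.single_eq_of_ne hj]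
  · refine Units.ext ?_
    ext k l
    simp only [diagGL, rootElt, transvection, Units.val_mul, mul_add, add_mul,
      Matrix.add_apply, diagonal_mul, mul_diagonal, Matrix.single_apply]
    congr 1
    · rcases eq_or_ne k l with rfl | h3
      · exact mul_comm _ _
      · rw [one_apply_ne h3, mul_zero, zero_mul]
    split_ifs with h2
    · obtain ⟨rfl, rfl⟩ := h2
      simp
      field_simp
    · simp

end Reindex

/-! ### Partial sums of weights -/

section PrefixSum

variable {n : ℕ}

/-- The sum of the first `k` entries of a weight. -/
def prefixSum (mu : Fin n → ℤ) (k : ℕ) : ℤ := ∑ r ∈ Finset.univ.filter (fun r : Fin n => (r : ℕ) < k), mu r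

theorem prefixSum_zero (mu : Fin n → ℤ) : prefixSum mu 0 = 0 := by simp [prefixSum]

theorem prefixSum_succ (mu : Fin n → ℤ) {k : ℕ} (hk : k < n) :
    prefixSum mu (k + 1) = prefixSum mu k + mu ⟨k, hk⟩ := by
  have : (Finset.univ.filter fun r : Fin n => (r : ℕ) < k + 1) =
      insert ⟨k, hk⟩ (Finset.univ.filter fun r : Fin n => (r : ℕ) < k) := by
    ext r
    simp only [Finset.mem_filter, Finset.mem_univ, true_and, Finset.mem_insert, Fin.ext_iff]
    omega
  rw [prefixSum, this, Finset.sum_insert (by simp), add_comm, prefixSum]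

theorem prefixSum_add (mu nu : Fin n → ℤ) (k : ℕ) :
    prefixSum (mu + nu) k = prefixSum mu k + prefixSum nu k := Finset.sum_add_distrib

theorem prefixSum_sub (mu nu : Fin n → ℤ) (k : ℕ) :
    prefixSum (mu - nu) k = prefixSum mu k - prefixSum nu k := Finset.sum_sub_distrib ..

theorem prefixSum_single (i : Fin n) (x : ℤ) (k : ℕ) :
    prefixSum (Pi.single i x) k = if (i : ℕ) < k then x else 0 := by
  simp [prefixSum]

theorem prefixSum_mono {mu : Fin n → ℤ} {k l : ℕ} (hkl : k ≤ l)
    (h : ∀ r : Fin n, k ≤ r → (r : ℕ) < l → 0 ≤ mu r) : prefixSum mu k ≤ prefixSum mu l := by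
  refine Finset.sum_le_sum_of_subset_of_nonneg (fun r hr => ?_) fun r hr hr' => ?_
  · simp only [Finset.mem_filter, Finset.mem_univ, true_and] at hr ⊢
    omega
  · simp only [Finset.mem_filter, Finset.mem_univ, true_and] at hr hr'
    exact h r (by omega) hr

theorem prefixSum_congr {mu nu : Fin n → ℤ} {k : ℕ} (h : ∀ r : Fin n, (r : ℕ) < k → mu r = nu r) :
    prefixSum mu k = prefixSum nu k :=
  Finset.sum_congr rfl fun r hr => h r (by simpa using hr)

theorem prefixSum_eq_sum_subtype (mu : Fin n → ℤ) (k : ℕ) :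
    prefixSum mu k = ∑ a : {r : Fin n // (r : ℕ) < k}, mu a :=
  Finset.sum_subtype _ (by simp) mu

theorem prefixSum_dropTwo {m : ℕ} (mu : Fin (m + 2) → ℤ) {k : ℕ} (hk : k ≤ m) :
    prefixSum (dropTwo mu) k = prefixSum mu k := by
  induction k with
  | zero => rw [prefixSum_zero, prefixSum_zero]
  | succ k ih =>
    rw [prefixSum_succ _ (by omega : k < m), prefixSum_succ _ (by omega : k < m + 2),
      ih (by omega)]
    rfl

theorem rootSum_eq_single_sub_single {i j : Fin n} (h : i ≤ j) :
    rootSum n i j = Pi.single i 1 - Pi.single j 1 := by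
  funext k
  have key : ∀ b : ℕ, (i : ℕ) ≤ b → rootSum n i b k =
      (if (k : ℕ) = i then 1 else 0) - (if (k : ℕ) = b then 1 else 0) := by
    intro b hb
    induction b, hb using Nat.le_induction with
    | base => simp [rootSum]
    | succ b hb ih =>
      have : rootSum n i (b + 1) = rootSum n i b + simpleRoot n b :=
        Finset.sum_Ico_succ_top hb _
      rw [this, Pi.add_apply, ih, simpleRoot]
      ring
  rw [key j h]
  simp [Pi.single_apply, Fin.ext_iff]

/-- The partial sums of a simple root are 0 or 1, and its total is 0. -/
theorem Subdominant.prefixSum_le_and {mu lam : Fin n → ℤ} (h : Subdominant mu lam) :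
    (∀ k, prefixSum mu k ≤ prefixSum lam k) ∧ prefixSum mu n = prefixSum lam n := by
  suffices (∀ k, 0 ≤ prefixSum (lam - mu) k) ∧ prefixSum (lam - mu) n = 0 by
    simpa only [prefixSum_sub, sub_nonneg, sub_eq_zero, eq_comm] using this
  refine AddSubmonoid.closure_induction
    (motive := fun x _ => (∀ k, 0 ≤ prefixSum x k) ∧ prefixSum x n = 0) ?_ ?_ ?_ h
  · rintro _ ⟨r, hr, rfl⟩
    have : simpleRoot n r = Pi.single ⟨r, by omega⟩ 1 - Pi.single ⟨r + 1, hr⟩ 1 := by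
      funext k
      simp [simpleRoot, Pi.single_apply, Fin.ext_iff]
    simp only [this, prefixSum_sub, prefixSum_single]
    refine ⟨fun k => ?_, ?_⟩
    · split_ifs <;> omega
    · split_ifs <;> omega
  · simp [prefixSum]
  · rintro x y _ _ ⟨hx, hx'⟩ ⟨hy, hy'⟩
    refine ⟨fun k => ?_, ?_⟩
    · rw [prefixSum_add]; exact add_nonneg (hx k) (hy k)
    · rw [prefixSum_add, hx', hy', add_zero]

theorem Subdominant.prefixSum_le {mu lam : Fin n → ℤ} (h : Subdominant mu lam) (k : ℕ) :
    prefixSum mu k ≤ prefixSum lam k := h.prefixSum_le_and.1 k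

theorem Subdominant.prefixSum_eq {mu lam : Fin n → ℤ} (h : Subdominant mu lam) :
    prefixSum mu n = prefixSum lam n := h.prefixSum_le_and.2

end PrefixSum

/-! ### Root subgroups acting on weight vectors of a polynomial module -/

section Polynomial

variable {F : Type*} [Field F] {m : ℕ} {V : Type*} [AddCommGroup V] [Module F V]
  {ρ : Representation F (GL (Fin (m + 2)) F) V} {lam : Fin (m + 2) → ℤ}

/-- Swapping r with the last coordinate gives another weight below λ. Equal totals together with the
inequality for the first n - 1 entries make its last entry at least that of λ, which is 0. -/
theorem IsWeight.nonneg (hρ : IsSimpleOfHighestWeight ρ lam) (hult : lam (ult m) = 0)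
    {mu : Fin (m + 2) → ℤ} (h : IsWeight ρ mu) (r : Fin (m + 2)) : 0 ≤ mu r := by
  have h1 := hρ.subdominant _ (h.comp_perm (Equiv.swap r (ult m)))
  have h2 := h1.prefixSum_le (m + 1)
  have h3 := h1.prefixSum_eq
  rw [prefixSum_succ _ (Nat.lt_succ_self (m + 1)),
    prefixSum_succ lam (Nat.lt_succ_self (m + 1))] at h3
  have h4 : (⟨m + 1, Nat.lt_succ_self (m + 1)⟩ : Fin (m + 2)) = ult m := rfl
  rw [h4, hult, Function.comp, Equiv.swap_apply_right] at h3
  omega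

/-- A term of degree at least 2 would have a negative j-th entry in its weight. -/
theorem exists_rootElt_linear [Infinite F] (hρ : IsSimpleOfHighestWeight ρ lam)
    (hult : lam (ult m) = 0) {i j : Fin (m + 2)} (h : i ≠ j) {nu : Fin (m + 2) → ℤ} {v : V}
    (hv : v ∈ weightSpace ρ nu) (hj : nu j ≤ 1) :
    ∃ w ∈ weightSpace ρ (nu + (Pi.single i 1 - Pi.single j 1)),
      ∀ c, ρ (rootElt i j h c) v = v + c • w := by
  obtain ⟨a, h0, ha, hs⟩ := exists_rootElt_expansion hρ.rational h hv
  refine ⟨a 1, by simpa using ha 1, fun c => ?_⟩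
  rw [hs, sum_pow_smul_of_eq_zero (N := 2)]
  · simp [Finset.sum_range_succ, h0]
  · intro q hq
    by_contra hne
    have := (isWeight_of_mem hne (ha q)).nonneg hρ hult j
    simp only [Pi.add_apply, Pi.smul_apply, Pi.sub_apply, Pi.single_eq_same,
      Pi.single_eq_of_ne h.symm, smul_eq_mul] at this
    omega

theorem rootElt_fixed_of_nonpos [Infinite F] (hρ : IsSimpleOfHighestWeight ρ lam)
    (hult : lam (ult m) = 0) {i j : Fin (m + 2)} (h : i ≠ j) {nu : Fin (m + 2) → ℤ} {v : V}
    (hv : v ∈ weightSpace ρ nu) (hj : nu j ≤ 0) (c : F) : ρ (rootElt i j h c) v = v := by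
  obtain ⟨w, hw, hs⟩ := exists_rootElt_linear hρ hult h hv (by omega)
  have : w = 0 := by
    by_contra hne
    have := (isWeight_of_mem hne hw).nonneg hρ hult j
    simp only [Pi.add_apply, Pi.sub_apply, Pi.single_eq_same, Pi.single_eq_of_ne h.symm] at this
    omega
  rw [hs, this, smul_zero, add_zero]

/-- Commutator relation, arranged so that on a vector fixed by `rootElt b d` the left side involves
`rootElt a b` alone. -/
theorem rootElt_mul_rootElt {n : ℕ} {a b d : Fin n} (hab : a ≠ b) (hbd : b ≠ d) (had : a ≠ d)
    (x y : F) : rootElt a b hab x * rootElt b d hbd y =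
      rootElt b d hbd y * (rootElt a d had (x * y) * rootElt a b hab x) := by
  refine Units.ext ?_
  simp only [rootElt, Units.val_mul, transvection, add_mul, mul_add, mul_one, one_mul,
    single_mul_single_same]
  simp only [single_mul_single_of_ne _ _ _ _ had.symm]
  simp
  abel

/-- Weight vectors in degree below the top for the first `s` coordinates are detected by the root
elements `(s, n - 1)` and `(s, n)`, if the entries of the weight after `s` are small. -/
theorem eq_zero_of_rootElt_last_fixed [Infinite F] (hρ : IsSimpleOfHighestWeight ρ lam)
    (hult : lam (ult m) = 0) {s : Fin (m + 2)} {nu : Fin (m + 2) → ℤ} {v : V}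
    (hv : v ∈ weightSpace ρ nu) (hle : ∀ b, s < b → nu b ≤ 1)
    (hmid : ∀ b, s < b → b ≠ penult m → b ≠ ult m → nu b ≤ 0)
    (hpre : ∀ k : ℕ, k ≤ s → prefixSum nu k = prefixSum lam k)
    (hlt : prefixSum nu (s + 1) < prefixSum lam (s + 1))
    (h1 : ∀ h c, ρ (rootElt s (penult m) h c) v = v)
    (h2 : ∀ h c, ρ (rootElt s (ult m) h c) v = v) : v = 0 := by
  refine eq_zero_of_rootElt_fixed hρ
    (Equiv.sumCompl fun r : Fin (m + 2) => (r : ℕ) < s + 1) ?_ hv ?_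
  · simpa only [prefixSum_eq_sum_subtype, Equiv.sumCompl_apply_inl] using hlt
  · rintro ⟨a, ha⟩ ⟨b, hb⟩
    simp only [Equiv.sumCompl_apply_inl, Equiv.sumCompl_apply_inr]
    intro h c
    have hsb : s < b := by rw [Fin.lt_def]; omega
    -- In row s the last two columns are given; in any other column the root element acts trivially
    -- because the entry there cannot decrease.
    by_cases has : a = s
    · subst has
      by_cases hb1 : b = penult m
      · subst hb1; exact h1 h c
      by_cases hb2 : b = ult m
      · subst hb2; exact h2 h c
      exact rootElt_fixed_of_nonpos hρ hult h hv (hmid b hsb hb1 hb2) c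
    -- In a row a < s the partial sum of ν at a + 1 already equals that of λ, so moving a unit from
    -- b to a would leave the dominance order.
    · obtain ⟨w, hw, hs⟩ := exists_rootElt_linear hρ hult h hv (hle b hsb)
      have : w = 0 := by
        by_contra hne
        have h3 := (hρ.subdominant _ (isWeight_of_mem hne hw)).prefixSum_le (a + 1)
        have has' : (a : ℕ) ≠ s := fun h => has (Fin.ext h)
        rw [prefixSum_add, prefixSum_sub, prefixSum_single, prefixSum_single,
          hpre _ (by omega), if_pos (by omega), if_neg (by omega)] at h3
        omega
      rw [hs, this, smul_zero, add_zero]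

/-- There are no vectors of weight `lam - 2 ε_s + ε_{n-1} + ε_n` annihilated by `E_{n-1,n}`. -/
theorem eq_zero_of_mem_rootKer [Infinite F] (hρ : IsSimpleOfHighestWeight ρ lam)
    {s : Fin (m + 2)} (hs : ∀ r, s < r → lam r = 0) (hsm : (s : ℕ) < m) {M N : Fin (m + 2)}
    (hM : penult m = M) (hN : ult m = N) (hMN : M ≠ N) {v : V}
    (hv : v ∈ weightSpace ρ (lam - Pi.single s 2 + Pi.single M 1 + Pi.single N 1))
    (hker : v ∈ rootKer ρ M N hMN) : v = 0 := by
  have hMv : (M : ℕ) = m := hM ▸ rfl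
  have hNv : (N : ℕ) = m + 1 := hN ▸ rfl
  have hsM : s ≠ M := fun h => by rw [h] at hsm; omega
  have hsN : s ≠ N := fun h => by rw [h] at hsm; omega
  have hult : lam N = 0 := hs _ (by rw [Fin.lt_def]; omega)
  have hpen : lam M = 0 := hs _ (by rw [Fin.lt_def]; omega)
  -- The linear coefficient vanishes by hypothesis; higher ones would have a negative N-entry.
  have hv1 : ∀ c, ρ (rootElt M N hMN c) v = v := by
    obtain ⟨a, h0, ha, hsum⟩ := exists_rootElt_expansion hρ.rational hMN hv
    have ha1 : a 1 = 0 := IsDividedPower.unique ⟨a, hsum, rfl⟩ hker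
    intro c
    rw [hsum, sum_pow_smul_of_eq_zero (N := 1)]
    · simp [h0]
    · intro q hq
      rcases Nat.lt_or_ge q 2 with h2 | h2
      · obtain rfl : q = 1 := by omega
        exact ha1
      · by_contra hne
        have := (isWeight_of_mem hne (ha q)).nonneg hρ (hN ▸ hult) N
        simp [hMN.symm, hsN.symm, hult] at this
        omega
  -- Here w = E_{s,M}v, x = E_{s,N}v, y = E_{s,N}w and u = E_{M,N}w.
  obtain ⟨w, hw, hvw⟩ := exists_rootElt_linear hρ (hN ▸ hult) hsM hv (by
    simp [hMN, hsM.symm, hpen])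
  obtain ⟨x, hx, hvx⟩ := exists_rootElt_linear hρ (hN ▸ hult) hsN hv (by
    simp [hMN.symm, hsN.symm, hult])
  obtain ⟨y, hy, hwy⟩ := exists_rootElt_linear hρ (hN ▸ hult) hsN hw (by
    simp [hMN.symm, hsN.symm, hult])
  obtain ⟨u, hu, hwu⟩ := exists_rootElt_linear hρ (hN ▸ hult) hMN hw (by
    simp [hMN.symm, hsN.symm, hult])
  have hx1 : ∀ c, ρ (rootElt M N hMN c) x = x := rootElt_fixed_of_nonpos hρ (hN ▸ hult) hMN hx (by
    simp [hMN.symm, hsN.symm, hult])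
  have hy1 : ∀ c, ρ (rootElt M N hMN c) y = y := rootElt_fixed_of_nonpos hρ (hN ▸ hult) hMN hy (by
    simp [hMN.symm, hsN.symm, hult])
  -- The commutator relation with parameters c and 1, applied to `v`; the (M, N) root subgroup fixes
  -- `v`, `x` and `y`.
  have hrel : ∀ c : F, c • (x + u + c • y) = 0 := by
    intro c
    have h1 := congrArg (fun g => ρ g v) (rootElt_mul_rootElt hsM hMN hsN c 1)
    simp only [map_mul, Module.End.mul_apply, hv1, hvw, map_add, map_smul, hvx, hwy, hwu, hx1,
      hy1, mul_one, one_smul] at h1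
    have h2 : c • (x + u + c • y) = (v + c • x + c • (w + u + c • y)) - (v + c • w) := by
      simp only [smul_add]; abel
    rw [h2, h1, sub_self]
  -- Comparing c = 1 with a value other than 0 and 1 isolates the quadratic term.
  have hy0 : y = 0 := by
    classical
    obtain ⟨c, hc⟩ := Infinite.exists_notMem_finset ({0, 1} : Finset F)
    simp only [Finset.mem_insert, Finset.mem_singleton, not_or] at hc
    have h1 := hrel 1
    have h2 := (smul_eq_zero.1 (hrel c)).resolve_left hc.1
    rw [one_smul, one_smul] at h1
    have h3 : (c - 1) • y = 0 := by
      rw [sub_smul, one_smul, ← sub_eq_zero.2 (h2.trans h1.symm)]; abel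
    exact (smul_eq_zero.1 h3).resolve_left (sub_ne_zero.2 hc.2)
  -- The weight of `w` is λ - ε_s + ε_N: its M-entry is 0, so E_{s,M} kills it, and E_{s,N}w = y =
  -- 0.
  have hw0 : w = 0 := by
    refine eq_zero_of_rootElt_last_fixed (s := s) hρ (hN ▸ hult) hw ?_ ?_ ?_ ?_ ?_ ?_
    · intro b hb
      simp only [Pi.add_apply, Pi.sub_apply, Pi.single_apply, hs b hb, hb.ne', if_false]
      split_ifs <;> omega
    · rw [hM, hN]
      intro b hb hbM hbN
      simp [hs b hb, hb.ne', hbM, hbN]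
    · intro k hk
      simp only [prefixSum_add, prefixSum_sub, prefixSum_single]
      split_ifs <;> omega
    · simp only [prefixSum_add, prefixSum_sub, prefixSum_single]
      split_ifs <;> omega
    · rw [hM]
      intro h c
      refine rootElt_fixed_of_nonpos hρ (hN ▸ hult) h hw ?_ c
      simp [hMN, hsM.symm, hpen]
    · rw [hN]
      intro h c
      rw [hwy, hy0, smul_zero, add_zero]
  have hu0 : u = 0 := by
    have := hwu 1
    rw [hw0, map_zero, zero_add, one_smul] at this
    exact this.symm
  have hx0 : x = 0 := by
    have := hrel 1
    rwa [one_smul, hu0, hy0, smul_zero, add_zero, add_zero] at this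
  refine eq_zero_of_rootElt_last_fixed (s := s) hρ (hN ▸ hult) hv ?_ ?_ ?_ ?_ ?_ ?_
  · intro b hb
    simp only [Pi.add_apply, Pi.sub_apply, Pi.single_apply, hs b hb, hb.ne', if_false]
    split_ifs <;> omega
  · rw [hM, hN]
    intro b hb hbM hbN
    simp [hs b hb, hb.ne', hbM, hbN]
  · intro k hk
    simp only [prefixSum_add, prefixSum_sub, prefixSum_single]
    split_ifs <;> omega
  · simp only [prefixSum_add, prefixSum_sub, prefixSum_single]
    split_ifs <;> omega
  · rw [hM]
    intro h c
    rw [hvw, hw0, smul_zero, add_zero]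
  · rw [hN]
    intro h c
    rw [hvx, hx0, smul_zero, add_zero]

end Polynomial

/-! ### Levels and composition factors -/

section Level

variable {F : Type*} [Field F] {m : ℕ} {V : Type*} [AddCommGroup V] [Module F V]
  {ρ : Representation F (GL (Fin (m + 2)) F) V} {lam : Fin (m + 2) → ℤ}

/-- The torus of the last two coordinates acts on a level by a scalar, which only the last two
entries of `nu` determine. -/
theorem diagGL_apply_of_mem_level {a b : ℤ} {v : V} (hv : v ∈ level ρ lam a b)
    {nu : Fin (m + 2) → ℤ} (h1 : nu (penult m) = lam (penult m) + a)
    (h2 : nu (ult m) = lam (ult m) + b) {t : Fin (m + 2) → Fˣ}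
    (ht : ∀ k : Fin m, t (Fin.castAdd 2 k) = 1) :
    ρ (diagGL t) v = character F nu t • v := by
  have key : level ρ lam a b ≤
      LinearMap.ker (ρ (diagGL t) - character F nu t • LinearMap.id) := by
    refine iSup₂_le fun mu hmu x hx => ?_
    rw [LinearMap.mem_ker, LinearMap.sub_apply, LinearMap.smul_apply, LinearMap.id_apply,
      mem_weightSpace_iff.1 hx t, sub_eq_zero]
    congr 1
    unfold character
    rw [Fin.prod_univ_add, Fin.prod_univ_add]
    simp [ht, Fin.prod_univ_two, hmu.1, hmu.2, h1, h2]
  exact sub_eq_zero.1 (LinearMap.mem_ker.1 (key hv))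

theorem eq_of_mem_level_of_mem_weightSpace [Infinite F] {a b : ℤ} {v : V} (hv0 : v ≠ 0)
    (hv : v ∈ level ρ lam a b) {nu : Fin (m + 2) → ℤ} (hnu : v ∈ weightSpace ρ nu) :
    nu (penult m) = lam (penult m) + a ∧ nu (ult m) = lam (ult m) + b := by
  -- The first m entries are placeholders.
  let mu : Fin (m + 2) → ℤ := Fin.append (fun _ => 0) ![lam (penult m) + a, lam (ult m) + b]
  have h1 : mu (penult m) = lam (penult m) + a := by simp [mu]
  have h2 : mu (ult m) = lam (ult m) + b := by simp [mu]
  have key : ∀ j : Fin 2, nu (Fin.natAdd m j) = mu (Fin.natAdd m j) := by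
    intro j
    by_contra hne
    obtain ⟨z, hz⟩ := exists_unit_zpow_ne (F := F) hne
    have h3 := diagGL_apply_of_mem_level hv h1 h2 (t := Pi.mulSingle (Fin.natAdd m j) z)
      (fun k => Pi.mulSingle_eq_of_ne (fun h => by
        have := congrArg Fin.val h
        simp only [Fin.val_castAdd, Fin.val_natAdd] at this
        omega) _)
    have h4 := smul_left_injective F hv0 ((hnu _).symm.trans h3)
    refine hz (Units.ext ?_)
    rw [← character_mulSingle, ← character_mulSingle]
    exact h4
  exact ⟨(key 0).trans h1, (key 1).trans h2⟩

theorem blockEmb_val (g : GL (Fin m) F) : (blockEmb F m g : Matrix (Fin (m + 2)) (Fin (m + 2)) F) =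
    reindex finSumFinEquiv finSumFinEquiv
      (fromBlocks (g : Matrix (Fin m) (Fin m) F) 0 0 (1 : Matrix (Fin 2) (Fin 2) F)) := rfl

theorem exists_blockEmb_eq (g : GL (Fin (m + 2)) F)
    (h : ∀ a b : Fin (m + 2), m ≤ a ∨ m ≤ b →
      (g : Matrix (Fin (m + 2)) (Fin (m + 2)) F) a b = (1 : Matrix _ _ F) a b) :
    ∃ g', blockEmb F m g' = g := by
  let M : Matrix (Fin m) (Fin m) F := Matrix.of fun a b => g.val (Fin.castAdd 2 a) (Fin.castAdd 2 b)
  have hM : g.val = reindex finSumFinEquiv finSumFinEquiv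
      (fromBlocks M 0 0 (1 : Matrix (Fin 2) (Fin 2) F)) := by
    ext a b
    obtain ⟨a, rfl⟩ := finSumFinEquiv.surjective a
    obtain ⟨b, rfl⟩ := finSumFinEquiv.surjective b
    rcases a with a | a <;> rcases b with b | b
    · simp [M]
    all_goals
      rw [h _ _ (by simp)]
      simp [one_apply, Fin.ext_iff]
      try omega
  have hdet : M.det ≠ 0 := by
    have h1 : g.val.det ≠ 0 := (GeneralLinearGroup.det g).ne_zero
    rw [hM, det_reindex_self, det_fromBlocks_zero₂₁, det_one, mul_one] at h1
    exact h1
  exact ⟨GeneralLinearGroup.mkOfDetNeZero M hdet, Units.ext hM.symm⟩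

theorem blockEmb_diagGL_mul (t : Fin (m + 2) → Fˣ) :
    diagGL t = blockEmb F m (diagGL fun k => t (Fin.castAdd 2 k)) *
      diagGL (Fin.append (fun _ => 1) fun j => t (Fin.natAdd m j)) := by
  have h : blockEmb F m (diagGL fun k => t (Fin.castAdd 2 k)) =
      diagGL (Fin.append (fun k => t (Fin.castAdd 2 k)) fun _ => 1) := by
    refine Units.ext ?_
    rw [blockEmb_val]
    ext a b
    obtain ⟨a, rfl⟩ := finSumFinEquiv.surjective a
    obtain ⟨b, rfl⟩ := finSumFinEquiv.surjective b
    rcases a with a | a <;> rcases b with b | b <;>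
    simp [diagGL, diagonal_apply, one_apply, Fin.ext_iff] <;> omega
  rw [h, ← diagGL_mul]
  congr 1
  funext k
  refine Fin.addCases (fun k => ?_) (fun k => ?_) k <;> simp

theorem character_append (nu : Fin (m + 2) → ℤ) (t : Fin (m + 2) → Fˣ) :
    character F nu t = character F (dropTwo nu) (fun k => t (Fin.castAdd 2 k)) *
      character F nu (Fin.append (fun _ => 1) fun j => t (Fin.natAdd m j)) := by
  unfold character dropTwo
  rw [Fin.prod_univ_add, Fin.prod_univ_add (fun k =>
    (Fin.append (fun _ => 1) fun j => t (Fin.natAdd m j) : Fin (m + 2) → Fˣ) k ^ nu k)]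
  simp

/-- Stability under GL_m covers the first m torus coordinates; the other two act on the level by
scalars. -/
theorem diagGL_mem_of_le_level {a b : ℤ} (B : Subrepresentation (restrictTwo ρ))
    (hB : B.toSubmodule ≤ level ρ lam a b) (t : Fin (m + 2) → Fˣ) {x : V}
    (hx : x ∈ B.toSubmodule) : ρ (diagGL t) x ∈ B.toSubmodule := by
  let mu : Fin (m + 2) → ℤ := Fin.append (fun _ => 0) ![lam (penult m) + a, lam (ult m) + b]
  have h1 : mu (penult m) = lam (penult m) + a := by simp [mu]
  have h2 : mu (ult m) = lam (ult m) + b := by simp [mu]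
  rw [blockEmb_diagGL_mul, map_mul, Module.End.mul_apply,
    diagGL_apply_of_mem_level (hB hx) h1 h2 (by simp), map_smul]
  exact B.toSubmodule.smul_mem _ (B.apply_mem_toSubmodule _ hx)

/-- Because k ≤ m, the block GL_k lies inside the embedded GL_m. -/
theorem leftStable_of_subrepresentation (B : Subrepresentation (restrictTwo ρ)) {k : ℕ}
    (hk : k ≤ m) : LeftStable
      (blockRep ρ (Equiv.sumCompl fun r : Fin (m + 2) => (r : ℕ) < k)) B.toSubmodule := by
  intro g x hx
  obtain ⟨g', hg'⟩ := exists_blockEmb_eq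
    (blockIso F (Equiv.sumCompl fun r : Fin (m + 2) => (r : ℕ) < k) (levi (g, 1))) (by
      intro a b hab
      rw [blockIso_val]
      obtain ⟨a, rfl⟩ := (Equiv.sumCompl fun r : Fin (m + 2) => (r : ℕ) < k).surjective a
      obtain ⟨b, rfl⟩ := (Equiv.sumCompl fun r : Fin (m + 2) => (r : ℕ) < k).surjective b
      rw [reindex_apply, submatrix_apply, Equiv.symm_apply_apply, Equiv.symm_apply_apply]
      rcases a with ⟨a, ha⟩ | ⟨a, ha⟩ <;> rcases b with ⟨b, hb⟩ | ⟨b, hb⟩ <;>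
      simp only [Equiv.sumCompl_apply_inl, Equiv.sumCompl_apply_inr] at hab
      · omega
      · rw [one_apply_ne ((Equiv.injective _).ne Sum.inl_ne_inr)]
        simp [levi]
      · rw [one_apply_ne ((Equiv.injective _).ne Sum.inr_ne_inl)]
        simp [levi]
      · simp only [levi, MonoidHom.coe_mk, OneHom.coe_mk, fromBlocks_apply₂₂, Units.val_one,
          one_apply, Equiv.apply_eq_iff_eq, Sum.inr.injEq])
  rw [blockRep_apply, ← hg']
  exact B.apply_mem_toSubmodule g' hx

theorem dropTwo_isWeight_subquotient {A B : Subrepresentation (restrictTwo ρ)}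
    {mu : Fin (m + 2) → ℤ} {z : V}
    (hz : z ∈ weightSpace ρ mu) (hzB : z ∈ B.toSubmodule) (hzA : z ∉ A.toSubmodule) :
    IsWeight (subquotient A B) (dropTwo mu) := by
  refine isWeight_of_mem (v := Submodule.Quotient.mk ⟨z, hzB⟩) (fun h => hzA ?_) fun t => ?_
  · have h3 : (⟨z, hzB⟩ : B.toSubmodule) ∈ A.toSubmodule.comap B.toSubmodule.subtype :=
      (Submodule.Quotient.mk_eq_zero _).1 h
    exact h3
  · change Submodule.Quotient.mk (⟨ρ (blockEmb F m (diagGL t)) z, _⟩ : B.toSubmodule) = _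
    change _ = character F (dropTwo mu) t • Submodule.Quotient.mk _
    rw [← Submodule.Quotient.mk_smul]
    congr 1
    refine Subtype.ext ?_
    change ρ (blockEmb F m (diagGL t)) z = character F (dropTwo mu) t • z
    have h3 := blockEmb_diagGL_mul (F := F) (Fin.append t (fun _ : Fin 2 => 1))
    have h4 := character_append (F := F) mu (Fin.append t (fun _ : Fin 2 => 1))
    have h5 : (Fin.append (fun _ : Fin m => (1 : Fˣ)) fun _ : Fin 2 => 1) = 1 := by
      funext k
      refine Fin.addCases (fun k => ?_) (fun k => ?_) k <;> simp
    simp only [Fin.append_left, Fin.append_right, h5, diagGL_one, mul_one, character_one] at h3 h4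
    rw [← h3, ← h4]
    exact hz _

/-- Any lift of a weight vector decomposes into weight components; those of weight other than `nu`
fall into A, so the one of weight `nu` cannot. -/
theorem exists_weight_vector_of_isWeight_subquotient [Infinite F] (hρ : IsRational ρ)
    {A B : Subrepresentation (restrictTwo ρ)} (hAB : A ≤ B)
    {nu : Fin (m + 2) → ℤ} {a b : ℤ} (hB : B.toSubmodule ≤ level ρ lam a b)
    (h1 : nu (penult m) = lam (penult m) + a) (h2 : nu (ult m) = lam (ult m) + b)
    (h : IsWeight (subquotient A B) (dropTwo nu)) :
    ∃ z ∈ weightSpace ρ nu, z ∈ B.toSubmodule ∧ z ∉ A.toSubmodule := by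
  have hA : A.toSubmodule ≤ level ρ lam a b := le_trans hAB hB
  obtain ⟨y, hy, hy0⟩ := (Submodule.ne_bot_iff _).1 h
  obtain ⟨⟨x, hxB⟩, rfl⟩ := Submodule.Quotient.mk_surjective _ y
  have hxA : x ∉ A.toSubmodule := fun h => hy0 <|
    (Submodule.Quotient.mk_eq_zero (A.toSubmodule.comap B.toSubmodule.subtype)).2 h
  have hx : ∀ t, ρ (diagGL t) x - character F nu t • x ∈ A.toSubmodule := by
    intro t
    have h3 := hy fun k => t (Fin.castAdd 2 k)
    have h4 : ρ (blockEmb F m (diagGL fun k => t (Fin.castAdd 2 k))) x -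
        character F (dropTwo nu) (fun k => t (Fin.castAdd 2 k)) • x ∈ A.toSubmodule :=
      (Submodule.Quotient.eq (A.toSubmodule.comap B.toSubmodule.subtype)).1 h3
    rw [blockEmb_diagGL_mul, map_mul, Module.End.mul_apply,
      diagGL_apply_of_mem_level (hB hxB) h1 h2 (by simp), map_smul, character_append nu t,
      mul_comm (character F (dropTwo nu) _), mul_smul, ← smul_sub]
    exact A.toSubmodule.smul_mem _ h4
  obtain ⟨w, hw, rfl⟩ := hρ.exists_weight_sum x
  refine ⟨w nu, hw nu, weight_component_mem (fun t x hx => diagGL_mem_of_le_level B hB t hx)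
    hw hxB nu, fun hnuA => hxA (Submodule.sum_mem _ fun mu hmu => ?_)⟩
  by_cases hne : mu = nu
  · rwa [hne]
  · exact mem_of_forall_sub_smul_mem (f := fun t => ρ (diagGL t))
      (fun t x hx => diagGL_mem_of_le_level A hA t hx) character_injective w.support
      (fun mu _ t => hw mu t) hx hmu (fun h => hne (character_injective (F := F) h))

/-- If the highest weight `nu` of a composition factor of a level has the same partial sum as `lam`
at `k`, then its first `k` entries are those of `lam`. -/
theorem prefixSum_eq_of_isCompositionFactor [Infinite F]
    (hρ : IsSimpleOfHighestWeight ρ lam) {N : Submodule F V} {nu : Fin (m + 2) → ℤ} {a b : ℤ}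
    (hN : N ≤ level ρ lam a b)
    (h1 : nu (penult m) = lam (penult m) + a) (h2 : nu (ult m) = lam (ult m) + b)
    (hnu : Subdominant nu lam) (hcomp : IsCompositionFactor (restrictTwo ρ) N (dropTwo nu))
    {k : ℕ} (hk : k ≤ m) (hpre : prefixSum nu k = prefixSum lam k) {l : ℕ} (hl : l ≤ k) :
    prefixSum nu l = prefixSum lam l := by
  obtain ⟨A, B, hAB, hBN, hsimple⟩ := hcomp
  have hB := hBN.trans hN
  obtain ⟨x, hx, hxB, hxA⟩ := exists_weight_vector_of_isWeight_subquotient hρ.rational hAB hB h1 h2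
    hsimple.isWeight
  -- By `hpre` the lift `x` has top degree in the first k coordinates. Isotypicity then yields a
  -- weight of the same factor agreeing with λ there, and comparing it with the highest weight gives
  -- the reverse inequality.
  obtain ⟨mu, z, hz, hzB, hzA, hmu⟩ := exists_weight_eq_on_left hρ
    (Equiv.sumCompl fun r : Fin (m + 2) => (r : ℕ) < k)
    (fun mu h => by
      simpa only [prefixSum_eq_sum_subtype, Equiv.sumCompl_apply_inl] using h.prefixSum_le k)
    (leftStable_of_subrepresentation A hk) (leftStable_of_subrepresentation B hk) hAB
    (fun t x hx => diagGL_mem_of_le_level B hB t hx) hxB hxA hx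
    (by simpa only [prefixSum_eq_sum_subtype, Equiv.sumCompl_apply_inl] using hpre)
  have h5 := (hsimple.subdominant _
    (dropTwo_isWeight_subquotient hz hzB hzA)).prefixSum_le l
  rw [prefixSum_dropTwo _ (hl.trans hk), prefixSum_dropTwo _ (hl.trans hk)] at h5
  have h6 : prefixSum mu l = prefixSum lam l :=
    prefixSum_congr fun r hr => hmu ⟨r, hr.trans_le hl⟩
  exact le_antisymm (hnu.prefixSum_le l) (h6 ▸ h5)

/-! ### The weights ω and μ in terms of the standard basis. -/

theorem omegaWeight_eq {s i : Fin (m + 2)} (hi : (i : ℕ) ≤ m) (hs : (s : ℕ) ≤ m) :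
    omegaWeight lam s i = lam - (Pi.single i 1 - Pi.single (penult m) 1) -
      (Pi.single s 1 - Pi.single (penult m) 1) := by
  change lam - rootSum (m + 2) i (penult m) - rootSum (m + 2) s (penult m) = _
  rw [rootSum_eq_single_sub_single hi, rootSum_eq_single_sub_single hs]

theorem muWeight_eq {s i : Fin (m + 2)} (hi : (i : ℕ) ≤ m) (hs : (s : ℕ) ≤ m) :
    muWeight lam s i = lam - (Pi.single i 1 - Pi.single (penult m) 1) -
      (Pi.single s 1 - Pi.single (ult m) 1) := by
  have hs1 : s ≤ ult m := hs.trans (Nat.le_succ m)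
  change lam - rootSum (m + 2) i (penult m) - rootSum (m + 2) s (ult m) = _
  rw [rootSum_eq_single_sub_single hi, rootSum_eq_single_sub_single hs1]

end Level
end
end GLRep

/-! ### The shape of ν from its partial sums. -/

theorem proposition4 {F : Type*} [Field F] [IsAlgClosed F] (p : ℕ) (hp : p.Prime) [CharP F p]
    (hp2 : p ≠ 2) {m : ℕ} (lam : Fin (m + 2) → ℤ) (hdom : Antitone lam)
    (hpenult : lam (GLRep.penult m) = 0) (hult : lam (GLRep.ult m) = 0)
    (s : Fin (m + 2)) (hs : lam s ≠ 0) (hs' : ∀ r, s < r → lam r = 0)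
    (i : Fin (m + 2)) (hi : i < s)
    {V : Type*} [AddCommGroup V] [Module F V] (ρ : Representation F (Matrix.GeneralLinearGroup (Fin (m + 2)) F) V)
    (hρ : GLRep.IsSimpleOfHighestWeight ρ lam)
    (nu : Fin (m + 2) → ℤ)
    (hnu : ∃ v : V, v ≠ 0 ∧ v ∈ GLRep.weightSpace ρ nu ∧ v ∈ GLRep.levelTimes ρ lam 1 1)
    (hle : GLRep.Subdominant (GLRep.dropTwo (GLRep.omegaWeight lam s i)) (GLRep.dropTwo nu))
    (hcomp : GLRep.IsCompositionFactor (GLRep.restrictTwo ρ) (GLRep.levelTimes ρ lam 1 1)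
      (GLRep.dropTwo nu)) :
    ∃ j : Fin (m + 2), i ≤ j ∧ j < s ∧ nu = GLRep.muWeight lam s j := by
  open GLRep in
  have hinf : Infinite F := IsAlgClosed.instInfinite
  obtain ⟨v, hv0, hv, hvN⟩ := hnu
  have hMv : (penult m : ℕ) = m := rfl
  have hNv : (ult m : ℕ) = m + 1 := rfl
  have hsm : (s : ℕ) < m := by
    by_contra h
    have h1 : lam s ≤ lam (penult m) := hdom (by rw [Fin.le_def]; omega)
    rcases Nat.eq_or_lt_of_le (Nat.le_of_not_lt h) with h2 | h2
    · have : s = penult m := Fin.ext h2.symm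
      exact hs (this ▸ hpenult)
    · have : s = ult m := Fin.ext (by have := s.2; omega)
      exact hs (this ▸ hult)
  have hi' : (i : ℕ) < s := hi
  have hweight := isWeight_of_mem hv0 hv
  have hsub := hρ.subdominant nu hweight
  obtain ⟨h1, h2⟩ := eq_of_mem_level_of_mem_weightSpace hv0 hvN.1 hv
  have hnonneg := hweight.nonneg hρ hult
  have homega : ∀ k ≤ m, prefixSum lam k - prefixSum nu k ≤
      (if (i : ℕ) < k then 1 else 0) + (if (s : ℕ) < k then 1 else 0) := by
    intro k hk
    have h3 := hle.prefixSum_le k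
    rw [prefixSum_dropTwo _ hk, prefixSum_dropTwo _ hk,
      omegaWeight_eq (by omega) hsm.le] at h3
    simp only [prefixSum_sub, prefixSum_single, hMv, if_neg (by omega : ¬ m < k)] at h3
    linarith
  have htotal : prefixSum lam m - prefixSum nu m = 2 := by
    have h3 := hle.prefixSum_eq
    rw [prefixSum_dropTwo _ le_rfl, prefixSum_dropTwo _ le_rfl,
      omegaWeight_eq (by omega) hsm.le] at h3
    simp only [prefixSum_sub, prefixSum_single, hMv, lt_irrefl, if_false, if_pos hsm,
      if_pos (hi'.trans hsm)] at h3
    linarith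
  -- After s the entries of λ vanish and those of ν are nonnegative, so the difference can only
  -- fall; it ends at 2 and never exceeds 2.
  have hhigh : ∀ k : ℕ, s < k → k ≤ m → prefixSum lam k - prefixSum nu k = 2 := by
    intro k hk hkm
    have h3 := homega k hkm
    have h4 : prefixSum nu k ≤ prefixSum nu m := prefixSum_mono hkm fun r _ _ => hnonneg r
    have h5 : prefixSum (-lam) k ≤ prefixSum (-lam) m := prefixSum_mono hkm fun r hr _ => by
      rw [Pi.neg_apply, hs' r (by rw [Fin.lt_def]; omega), neg_zero]
    rw [← zero_sub, prefixSum_sub, prefixSum_sub] at h5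
    have h6 : ∀ k, prefixSum (0 : Fin (m + 2) → ℤ) k = 0 := fun k => by simp [prefixSum]
    rw [h6, h6] at h5
    split_ifs at h3 <;> omega
  let P : ℕ → Prop := fun k => prefixSum nu k = prefixSum lam k
  classical
  -- The last index up to s where the partial sums agree is the position from which the first unit
  -- is removed.
  set k := Nat.findGreatest P s with hk
  have hks : k ≤ s := Nat.findGreatest_le _
  have hPk : P k := Nat.findGreatest_spec (P := P) (Nat.zero_le _)
    ((prefixSum_zero _).trans (prefixSum_zero _).symm)
  -- The composition factor rules out that the difference rises to 1 and returns to 0 before k.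
  have hlow : ∀ l ≤ k, prefixSum nu l = prefixSum lam l := fun l hl =>
    prefixSum_eq_of_isCompositionFactor hρ inf_le_left h1 h2 hsub hcomp (by omega) hPk hl
  have hmid : ∀ l, k < l → l ≤ s → prefixSum lam l - prefixSum nu l = 1 := by
    intro l hl hls
    have h3 : ¬ P l := Nat.findGreatest_is_greatest hl hls
    have h4 : prefixSum nu l ≠ prefixSum lam l := h3
    have h5 := hsub.prefixSum_le l
    have h6 := homega l (by omega)
    rw [if_neg (by omega : ¬ (s : ℕ) < l)] at h6
    split_ifs at h6 <;> omega
  have hik : (i : ℕ) ≤ k := by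
    -- The partial sum at i omits the entry i, so the bound from ω_i is still 0 there.
    refine Nat.le_findGreatest hi'.le (le_antisymm (hsub.prefixSum_le _) ?_)
    have h3 := homega i (by omega)
    rw [if_neg (by omega), if_neg (by omega)] at h3
    omega
  have hentry : ∀ r : Fin (m + 2), prefixSum lam (r + 1) - prefixSum nu (r + 1) =
      prefixSum lam r - prefixSum nu r + (lam r - nu r) := by
    intro r
    rw [prefixSum_succ lam r.2, prefixSum_succ nu r.2]
    ring
  have hval : ∀ r : Fin (m + 2), r ≠ penult m → r ≠ ult m → (r : ℕ) < m := by
    intro r hr1 hr2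
    rw [Ne, Fin.ext_iff] at hr1 hr2
    omega
  rcases Nat.lt_or_ge k s with hlt | hge
  · refine ⟨⟨k, by omega⟩, hik, hlt, ?_⟩
    rw [muWeight_eq (by rw [Fin.val_mk]; omega) hsm.le]
    funext r
    simp only [Pi.sub_apply, Pi.single_apply, Fin.ext_iff, hMv, hNv]
    by_cases hr1 : r = penult m
    · subst hr1
      rw [h1, hMv]
      split_ifs <;> omega
    by_cases hr2 : r = ult m
    · subst hr2
      rw [h2, hNv]
      split_ifs <;> omega
    have hrm := hval r hr1 hr2
    have h3 := hentry r
    rcases lt_trichotomy (r : ℕ) s with hrs | hrs | hrs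
    · rcases lt_trichotomy (r : ℕ) k with hrk | hrk | hrk
      · have h4 := hlow r hrk.le
        have h5 := hlow (r + 1) hrk
        split_ifs <;> omega
      · have h4 := hlow r hrk.le
        have h5 := hmid (r + 1) (by omega) hrs
        split_ifs <;> omega
      · have h4 := hmid r hrk hrs.le
        have h5 := hmid (r + 1) (by omega) hrs
        split_ifs <;> omega
    · have h4 := hmid r (by omega) hrs.le
      have h5 := hhigh (r + 1) (by omega) hrm
      split_ifs <;> omega
    · have h4 := hhigh r hrs hrm.le
      have h5 := hhigh (r + 1) (by omega) hrm
      split_ifs <;> omega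
  -- If k = s, the difference jumps from 0 to 2 at position s, so both units come from the entry s.
  · refine absurd (eq_zero_of_mem_rootKer hρ hs' hsm rfl rfl (penult_ne_ult m) ?_ hvN.2) hv0
    convert hv using 2
    funext r
    simp only [Pi.sub_apply, Pi.add_apply, Pi.single_apply, Fin.ext_iff, hMv, hNv]
    by_cases hr1 : r = penult m
    · subst hr1
      rw [h1, hMv]
      split_ifs <;> omega
    by_cases hr2 : r = ult m
    · subst hr2
      rw [h2, hNv]
      split_ifs <;> omega
    have hrm := hval r hr1 hr2
    have h3 := hentry r
    rcases lt_trichotomy (r : ℕ) s with hrs | hrs | hrs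
    · have h4 := hlow r (by omega)
      have h5 := hlow (r + 1) (by omega)
      split_ifs <;> omega
    · have h4 := hlow r (by omega)
      have h5 := hhigh (r + 1) (by omega) hrm
      split_ifs <;> omega
    · have h4 := hhigh r hrs hrm.le
      have h5 := hhigh (r + 1) (by omega) hrm
      split_ifs <;> omega
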